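/- Consider a single flow of requests to unit-sized data items $1,2,3,\dots$ served by an LRU (equivalently, move-to-front) cache: the requests $(R_n)_{n\in\mathbb Z}$ are independent with $\mathbb P[R_n=i]=p_i$ for all $n\in\mathbb Z$, $i\ge 1$, where $p_i\sim c\,\exp(-i^{\xi})$ as $i\to\infty$ for some constants $c>0$ and $0<\xi<1/3$. In the move-to-front list found by request $R_0$ the items are sorted by recency of their last access before time $0$; let $C_0$ be the total size of the items in front of the item requested by $R_0$, that is, the number of distinct items requested since the last previous request to the item $R_0$. Then $$\lim_{x\to\infty}\frac{\mathbb P[C_0>x]}{\mathbb P[R_0>x]}=e^{\gamma},$$ where $\gamma$ is Euler's constant. The same limit holds if $C_0$ is replaced by the position $C_0+1$ of the requested item in the list. -/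

import Mathlib

open MeasureTheory ProbabilityTheory Filter Topology Asymptotics
open scoped NNReal ENNReal

/-- For a sequence of requests `r : ℤ → D` to data items (`r j` is the item requested at the `j`-th
arrival, `j` ranging over all integers), `MTFBefore r n a b` says that, in the move-to-front list
found by request `n`, item `a` stands in front of item `b`. The list is sorted by recency of the
last access, so this means that the last access to `a` before request `n` is more recent than the
last access to `b`: `a` is requested at some `j < n` such that `b` is not requested at any of
`j, …, n - 1`. -/
def MTFBefore {D : Type*} (r : ℤ → D) (n : ℤ) (a b : D) : Prop :=
  ∃ j : ℤ, j < n ∧ r j = a ∧ ∀ k : ℤ, j ≤ k → k < n → r k ≠ b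

/-- `C_n`: the total size (item `d` has size `s d`) of all data items that stand, in the
move-to-front list found by request `n`, in front of the item `r n` which is requested.
It may be infinite only if infinitely many distinct items have been requested since the last
request to `r n`. -/
noncomputable def mtfCost {D : Type*} (s : D → ℝ≥0) (r : ℤ → D) (n : ℤ) : ℝ≥0∞ :=
  ∑' d : {d : D // MTFBefore r n d (r n)}, (s d.1 : ℝ≥0∞)

/-- Every set of positive integers is measurable. -/
instance instMeasurableSpacePNatTop : MeasurableSpace ℕ+ := ⊤

instance instDiscreteMeasurableSpacePNatTop : DiscreteMeasurableSpace ℕ+ := ⟨fun _ => trivial⟩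

/-- The requests `R n`, `n ∈ ℤ`, of a single flow: independent random data items, labelled
`1, 2, 3, …`, with `ℙ[R n = i] = p i` for every `n` and `i`. -/
structure IsRequestFlow {Ω : Type*} [MeasurableSpace Ω] (μ : Measure Ω)
    (R : ℤ → Ω → ℕ+) (p : ℕ+ → ℝ) : Prop where
  measurable : ∀ n, Measurable (R n)
  indep : iIndepFun R μ
  law : ∀ n i, μ.real {ω | R n ω = i} = p i

/-! Let $D_n$ be the number of distinct items among the $n$ requests before time $0$, $m(n)$ its
mean (`meanDistinct`), and $q(n)=\sum_i p_i(1-p_i)^n$ the probability that $R_0$ is not among them.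
If $R_0$ is among them then $C_0+1\le D_n$; otherwise $D_n\le C_0$. With $k=\lfloor x\rfloor$, every
$n$ thus gives $q(n)-\mathbb P[D_n\le k]\le\mathbb P[C_0>x]$ and $\mathbb P[C_0+1>x]\le q(n)+\mathbb
P[D_n\ge k]$.

Take $n=\lfloor e^{k^\xi+a}/c\rfloor$. Replacing $(1-p_i)^n$ by $\exp(-e^{k^\xi+a-i^\xi})$ and using
$\int_0^\infty e^{-v}\log v\,dv=-\gamma$ gives $m(n)=k+(\gamma+a+o(1))\,k^{1-\xi}/\xi$
(`tendsto_meanDistinct`). Since $q$ is the decreasing increment of $m$, difference quotients of $m$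
yield $q(n)\sim e^{-a}\,\mathbb P[R_0>k]$ (`tendsto_fault_div_tail`).

For $a\ne-\gamma$ the mean misses $k$ by order $k^{1-\xi}$, so Chernoff bounds make the unwanted
deviation at most $\exp(-\mathrm{const}\cdot k^{1-2\xi})$. The tail is of order
$k^{1-\xi}e^{-k^\xi}$, so the deviation is negligible because $\xi<1/3$
(`tendsto_exp_neg_sq_div_tail`). Letting $a\downarrow-\gamma$ in the lower bound and
$a\uparrow-\gamma$ in the upper one gives $e^\gamma$. -/

/-! ### Distinct items in a window and the search cost -/

/-- The set of the items requested at the times `-1, …, -n`. -/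
def recentItems {D : Type*} [DecidableEq D] (r : ℤ → D) (n : ℕ) : Finset D :=
  (Finset.range n).image fun j : ℕ => r (-((j : ℤ) + 1))

lemma recentItems_succ {D : Type*} [DecidableEq D] (r : ℤ → D) (n : ℕ) :
    recentItems r (n + 1) = insert (r (-((n : ℤ) + 1))) (recentItems r n) := by
  simp [recentItems, Finset.range_add_one, Finset.image_insert]

lemma mem_recentItems {D : Type*} [DecidableEq D] {r : ℤ → D} {n : ℕ} {d : D} :
    d ∈ recentItems r n ↔ ∃ j : ℤ, -(n : ℤ) ≤ j ∧ j < 0 ∧ r j = d := by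
  simp only [recentItems, Finset.mem_image, Finset.mem_range]
  constructor
  · rintro ⟨j, hj, rfl⟩
    exact ⟨_, by omega, by omega, rfl⟩
  · rintro ⟨j, hj, hj0, rfl⟩
    refine ⟨(-j - 1).toNat, by omega, ?_⟩
    congr 1
    omega

lemma recentItems_eq_image_univ {D : Type*} [DecidableEq D] (r : ℤ → D) (n : ℕ) :
    recentItems r n = Finset.univ.image fun i : Finset.Ico (-(n : ℤ)) 0 => r i := by
  ext d
  simp only [Finset.mem_image, Finset.mem_univ, true_and, mem_recentItems]
  constructor
  · rintro ⟨j, h1, h2, rfl⟩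
    exact ⟨⟨j, Finset.mem_Ico.2 ⟨h1, h2⟩⟩, rfl⟩
  · rintro ⟨⟨j, hj⟩, rfl⟩
    rw [Finset.mem_Ico] at hj
    exact ⟨j, hj.1, hj.2, rfl⟩

lemma mtfCost_eq_encard {D : Type*} {s : D → ℝ≥0} (hs : ∀ d, s d = 1) (r : ℤ → D) (n : ℤ) :
    mtfCost s r n = ({d | MTFBefore r n d (r n)}.encard : ℝ≥0∞) := by
  rw [← ENNReal.tsum_set_one]
  simp only [mtfCost, hs, ENNReal.coe_one]
  rfl

/-- The last access to `r 0` lies in the window, so every item in front of it was requested later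
and also lies there; the `+ 1` counts `r 0` itself. -/
lemma mtfCost_add_one_le {D : Type*} [DecidableEq D] {s : D → ℝ≥0} (hs : ∀ d, s d = 1)
    {r : ℤ → D} {n : ℕ} (h : r 0 ∈ recentItems r n) :
    mtfCost s r 0 + 1 ≤ ((recentItems r n).card : ℝ≥0∞) := by
  rw [mtfCost_eq_encard hs]
  have hsub : {d | MTFBefore r 0 d (r 0)} ⊆ ((recentItems r n).erase (r 0) : Finset D) := by
    rintro d ⟨j, hj, rfl, hk⟩
    obtain ⟨i, hi, hi0, hir⟩ := mem_recentItems.1 h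
    have hij : i < j := by
      by_contra hc
      exact hk i (by omega) hi0 hir
    simp only [Finset.coe_erase, Set.mem_sdiff, Finset.mem_coe, Set.mem_singleton_iff]
    exact ⟨mem_recentItems.2 ⟨j, by omega, hj, rfl⟩, hk j le_rfl hj⟩
  have h1 := Set.encard_le_encard hsub
  rw [Set.encard_coe_eq_coe_finsetCard] at h1
  have h2 : ((recentItems r n).erase (r 0)).card + 1 = (recentItems r n).card :=
    Finset.card_erase_add_one h
  have h3 : (({d | MTFBefore r 0 d (r 0)}.encard : ℕ∞) : ℝ≥0∞)
      ≤ ((((recentItems r n).erase (r 0)).card : ℕ∞) : ℝ≥0∞) := by exact_mod_cast h1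
  rw [← h2]
  push_cast
  gcongr
  simpa using h3

/-- Whether the last access to `r 0` is older than the window or does not exist, everything
requested in the window stands in front of it. -/
lemma card_recentItems_le_mtfCost {D : Type*} [DecidableEq D] {s : D → ℝ≥0} (hs : ∀ d, s d = 1)
    {r : ℤ → D} {n : ℕ} (h : r 0 ∉ recentItems r n) :
    ((recentItems r n).card : ℝ≥0∞) ≤ mtfCost s r 0 := by
  rw [mtfCost_eq_encard hs]
  have hsub : (recentItems r n : Set D) ⊆ {d | MTFBefore r 0 d (r 0)} := by
    intro d hd
    obtain ⟨j, hj, hj0, rfl⟩ := mem_recentItems.1 (Finset.mem_coe.1 hd)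
    exact ⟨j, hj0, rfl, fun k hk hk0 hkr => h (mem_recentItems.2 ⟨k, by omega, hk0, hkr⟩)⟩
  have h1 := Set.encard_le_encard hsub
  rw [Set.encard_coe_eq_coe_finsetCard] at h1
  have h3 : (((recentItems r n).card : ℕ∞) : ℝ≥0∞)
      ≤ (({d | MTFBefore r 0 d (r 0)}.encard : ℕ∞) : ℝ≥0∞) := by exact_mod_cast h1
  simpa using h3

/-! ### Law of the requests and the fault probability -/

/-- The probability that an item of probability `x` is among `n` independent requests. -/
noncomputable def hitProb (x : ℝ) (n : ℕ) : ℝ := 1 - (1 - x) ^ n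

lemma hitProb_succ (x : ℝ) (n : ℕ) : hitProb x (n + 1) = hitProb x n + x * (1 - x) ^ n := by
  simp only [hitProb, pow_succ]; ring

lemma hitProb_nonneg {x : ℝ} (h0 : 0 ≤ x) (h1 : x ≤ 1) (n : ℕ) : 0 ≤ hitProb x n := by
  have : (1 - x) ^ n ≤ 1 := pow_le_one₀ (by linarith) (by linarith)
  simp only [hitProb]; linarith

lemma hitProb_le_one {x : ℝ} (h1 : x ≤ 1) (n : ℕ) : hitProb x n ≤ 1 := by
  have : 0 ≤ (1 - x) ^ n := pow_nonneg (by linarith) n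
  simp only [hitProb]; linarith

lemma hitProb_le_mul {x : ℝ} (h1 : x ≤ 1) (n : ℕ) : hitProb x n ≤ n * x := by
  have := one_add_mul_le_pow (a := -x) (by linarith) n
  simp only [hitProb, sub_eq_add_neg]
  linarith

namespace IsRequestFlow

variable {Ω : Type*} [MeasurableSpace Ω] {μ : Measure Ω} {R : ℤ → Ω → ℕ+} {p : ℕ+ → ℝ}

lemma nonneg (hR : IsRequestFlow μ R p) (i : ℕ+) : 0 ≤ p i := by
  rw [← hR.law 0 i]; exact measureReal_nonneg

lemma measurableSet_eq (hR : IsRequestFlow μ R p) (n : ℤ) (i : ℕ+) :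
    MeasurableSet {ω | R n ω = i} := hR.measurable n (measurableSet_singleton i)

lemma measure_preimage [IsProbabilityMeasure μ] (hR : IsRequestFlow μ R p) (n : ℤ) (i : ℕ+) :
    μ {ω | R n ω = i} = ENNReal.ofReal (p i) := by
  rw [← hR.law n i, ofReal_measureReal]

lemma le_one [IsProbabilityMeasure μ] (hR : IsRequestFlow μ R p) (i : ℕ+) : p i ≤ 1 := by
  rw [← hR.law 0 i]; exact measureReal_le_one

/-- Total probability over the item requested at time `n`. -/
lemma hasSum_measureReal_inter [IsProbabilityMeasure μ] (hR : IsRequestFlow μ R p) (n : ℤ)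
    {s : Set Ω} (hs : MeasurableSet s) :
    HasSum (fun i => μ.real ({ω | R n ω = i} ∩ s)) (μ.real s) := by
  have hU : (⋃ i, {ω | R n ω = i} ∩ s) = s := by ext; simp
  have h := measure_iUnion (μ := μ) (f := fun i => {ω | R n ω = i} ∩ s)
    (by
      intro i j hij
      rw [Function.onFun, Set.disjoint_left]
      rintro ω ⟨h1, -⟩ ⟨h2, -⟩
      exact hij (h1.symm.trans h2))
    (fun i => (hR.measurableSet_eq n i).inter hs)
  rw [hU] at h
  have h2 := ENNReal.hasSum_toReal (f := fun i => μ ({ω | R n ω = i} ∩ s))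
    (by rw [← h]; exact measure_ne_top _ _)
  rw [← ENNReal.tsum_toReal_eq (fun i => measure_ne_top _ _), ← h] at h2
  exact h2

lemma hasSum [IsProbabilityMeasure μ] (hR : IsRequestFlow μ R p) : HasSum p 1 := by
  have h := hR.hasSum_measureReal_inter 0 MeasurableSet.univ
  simpa [hR.law] using h

lemma tail_eq_tsum [IsProbabilityMeasure μ] (hR : IsRequestFlow μ R p) {x : ℝ} (hx : 0 ≤ x) :
    μ.real {ω | x < (R 0 ω : ℝ)} = ∑' j : ℕ, p (⌊x⌋₊ + j).succPNat := by
  have hs : MeasurableSet {ω | x < (R 0 ω : ℝ)} :=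
    hR.measurable 0 (MeasurableSet.of_discrete (s := {i : ℕ+ | x < (i : ℝ)}))
  have h := hR.hasSum_measureReal_inter 0 hs
  -- `succPNat` adds one, so `j = 0` is the item `⌊x⌋₊ + 1`, the first one above `x`.
  have hinj : Function.Injective (fun j : ℕ => (⌊x⌋₊ + j).succPNat) := by
    intro a b hab
    have := congrArg PNat.val hab
    simpa using this
  rw [← h.tsum_eq, ← hinj.tsum_eq]
  · refine tsum_congr fun j => ?_
    rw [← hR.law 0]
    congr 1
    ext ω
    simp only [Set.mem_inter_iff, Set.mem_ofPred_eq, and_iff_left_iff_imp]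
    intro hω
    rw [hω]
    have := Nat.lt_floor_add_one x
    simp only [Nat.succPNat_coe]
    push_cast
    have : (0 : ℝ) ≤ j := j.cast_nonneg
    linarith
  · intro i hi
    have hxi : x < (i : ℝ) := by
      by_contra hc
      apply hi
      have : {ω | R 0 ω = i} ∩ {ω | x < (R 0 ω : ℝ)} = ∅ := by
        ext ω
        simp only [Set.mem_inter_iff, Set.mem_ofPred_eq, Set.mem_empty_iff_false, iff_false, not_and]
        rintro rfl
        exact hc
      simp [this]
    have := (Nat.floor_lt hx).2 (show x < ((i : ℕ) : ℝ) from hxi)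
    refine ⟨i - 1 - ⌊x⌋₊, ?_⟩
    apply PNat.eq
    simp only [Nat.succPNat_coe, Nat.succ_eq_add_one]
    omega

/-- Given $R_0=i$, each of the `n` earlier requests misses `i` independently with probability
$1-p_i$. -/
lemma measureReal_notMem_recentItems [IsProbabilityMeasure μ] (hR : IsRequestFlow μ R p) (n : ℕ) :
    μ.real {ω | R 0 ω ∉ recentItems (fun j => R j ω) n} = ∑' i, p i * (1 - p i) ^ n := by
  have key (i : ℕ+) : {ω | R 0 ω = i} ∩ {ω | R 0 ω ∉ recentItems (fun j => R j ω) n} =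
      ⋂ j ∈ Finset.Icc (-(n : ℤ)) 0, R j ⁻¹' (if j = 0 then {i} else {i}ᶜ) := by
    ext ω
    simp only [Set.mem_inter_iff, Set.mem_ofPred_eq, mem_recentItems, Set.mem_iInter,
      Finset.mem_Icc, Set.mem_preimage]
    constructor
    · rintro ⟨rfl, h⟩ j ⟨hj, hj0⟩
      split_ifs with h0
      · simp [h0]
      · exact fun hc => h ⟨j, hj, by omega, hc⟩
    · intro h
      have h0 := h 0 ⟨by omega, le_rfl⟩
      simp only [if_true, Set.mem_singleton_iff] at h0
      refine ⟨h0, ?_⟩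
      rintro ⟨j, hj, hj0, hc⟩
      have := h j ⟨hj, hj0.le⟩
      rw [if_neg hj0.ne] at this
      exact this (hc.trans h0)
  have hprob (i : ℕ+) : μ.real ({ω | R 0 ω = i} ∩
      {ω | R 0 ω ∉ recentItems (fun j => R j ω) n}) = p i * (1 - p i) ^ n := by
    rw [key, measureReal_def, hR.indep.measure_inter_preimage_eq_mul (Finset.Icc (-(n : ℤ)) 0)
      (sets := fun j => if j = 0 then {i} else {i}ᶜ) (fun j _ => MeasurableSet.of_discrete),
      ENNReal.toReal_prod]
    have hsplit : Finset.Icc (-(n : ℤ)) 0 = insert 0 (Finset.Ico (-(n : ℤ)) 0) := by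
      ext j; simp only [Finset.mem_Icc, Finset.mem_insert, Finset.mem_Ico]; omega
    rw [hsplit, Finset.prod_insert (by simp)]
    congr 1
    · exact hR.law 0 i
    · rw [Finset.prod_congr rfl (g := fun _ => 1 - p i)]
      · simp
      · intro j hj
        have hj0 : j ≠ 0 := by simp only [Finset.mem_Ico] at hj; omega
        rw [if_neg hj0, Set.preimage_compl, ← measureReal_def,
          measureReal_compl (hR.measurable j (measurableSet_singleton i)), probReal_univ,
          ← hR.law j i]
        rfl
  have hs : MeasurableSet {ω | R 0 ω ∉ recentItems (fun j => R j ω) n} := by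
    have : {ω | R 0 ω ∉ recentItems (fun j => R j ω) n} =
        ⋃ i, {ω | R 0 ω = i} ∩ {ω | R 0 ω ∉ recentItems (fun j => R j ω) n} := by ext; simp
    rw [this]
    refine MeasurableSet.iUnion fun i => ?_
    rw [key]
    exact Finset.measurableSet_biInter _ fun j _ => hR.measurable j MeasurableSet.of_discrete
  rw [← (hR.hasSum_measureReal_inter 0 hs).tsum_eq]
  exact tsum_congr hprob

lemma measurable_recentItems_comp (hR : IsRequestFlow μ R p) (n : ℕ) {E : Type*}
    [MeasurableSpace E] (g : Finset ℕ+ → E) :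
    Measurable fun ω => g (recentItems (fun j => R j ω) n) := by
  have hm : Measurable (fun ω => fun i : Finset.Ico (-(n : ℤ)) 0 => R i ω) :=
    measurable_pi_lambda _ fun i => hR.measurable i
  have := (Measurable.of_discrete
    (f := fun t : Finset.Ico (-(n : ℤ)) 0 → ℕ+ => g (Finset.univ.image t))).comp hm
  convert! this using 2 with ω
  simp [recentItems_eq_image_univ (fun j => R j ω) n]

/-- Conditioning a function of the recent items on the oldest of these requests. -/
lemma lintegral_recentItems_succ [IsProbabilityMeasure μ] (hR : IsRequestFlow μ R p) (n : ℕ)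
    (g : Finset ℕ+ → ℝ≥0∞) :
    ∫⁻ ω, g (recentItems (fun j => R j ω) (n + 1)) ∂μ =
      ∑' i, ENNReal.ofReal (p i) * ∫⁻ ω, g (insert i (recentItems (fun j => R j ω) n)) ∂μ := by
  set T : Finset ℤ := {-((n : ℤ) + 1)} with hT
  set S : Finset ℤ := Finset.Ico (-(n : ℤ)) 0 with hS
  have hdisj : Disjoint T S := by
    rw [hT, Finset.disjoint_singleton_left, hS, Finset.mem_Ico]; omega
  have hind := hR.indep.indepFun_finset T S hdisj hR.measurable
  let φ : (S → ℕ+) → Finset ℕ+ := fun t => Finset.univ.image t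
  have hφ (ω : Ω) : φ (fun i : S => R i ω) = recentItems (fun j => R j ω) n :=
    (recentItems_eq_image_univ (fun j => R j ω) n).symm
  have hmeasT : Measurable (fun ω => fun i : T => R i ω) :=
    measurable_pi_lambda _ fun i => hR.measurable i
  have hmeasS : Measurable (fun ω => fun i : S => R i ω) :=
    measurable_pi_lambda _ fun i => hR.measurable i
  let e : T := ⟨-((n : ℤ) + 1), by simp [hT]⟩
  have hterm (i : ℕ+) : ENNReal.ofReal (p i) *
      ∫⁻ ω, g (insert i (recentItems (fun j => R j ω) n)) ∂μ =
      ∫⁻ ω, (if R (-((n : ℤ) + 1)) ω = i then 1 else 0) *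
        g (insert i (recentItems (fun j => R j ω) n)) ∂μ := by
    have hi := hind.comp (φ := fun t : T → ℕ+ => if t e = i then (1 : ℝ≥0∞) else 0)
      (ψ := fun t => g (insert i (φ t))) Measurable.of_discrete Measurable.of_discrete
    have h := lintegral_mul_eq_lintegral_mul_lintegral_of_indepFun
      (Measurable.of_discrete.comp hmeasT) (Measurable.of_discrete.comp hmeasS) hi
    simp only [Pi.mul_apply, Function.comp_def, hφ] at h
    rw [h]
    congr 1
    rw [← hR.measure_preimage (-((n : ℤ) + 1)) i,
      ← lintegral_indicator_one (hR.measurableSet_eq _ i)]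
    refine lintegral_congr fun ω => ?_
    simp [Set.indicator_apply, e]
  have hm (i : ℕ+) : Measurable fun ω => (if R (-((n : ℤ) + 1)) ω = i then (1 : ℝ≥0∞) else 0) *
        g (insert i (recentItems (fun j => R j ω) n)) := by
    have h1 : Measurable fun ω => (if R (-((n : ℤ) + 1)) ω = i then (1 : ℝ≥0∞) else 0) :=
      (Measurable.of_discrete (f := fun k : ℕ+ => if k = i then (1 : ℝ≥0∞) else 0)).comp
        (hR.measurable _)
    exact h1.mul (hR.measurable_recentItems_comp n fun A => g (insert i A))
  simp_rw [hterm]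
  rw [← lintegral_tsum fun i => (hm i).aemeasurable]
  refine lintegral_congr fun ω => ?_
  rw [recentItems_succ, tsum_eq_single (R (-((n : ℤ) + 1)) ω)]
  · rw [if_pos rfl, one_mul]
  · intro i hi
    rw [if_neg hi.symm, zero_mul]

lemma summable_hitProb [IsProbabilityMeasure μ] (hR : IsRequestFlow μ R p) (n : ℕ) :
    Summable fun i => hitProb (p i) n :=
  Summable.of_nonneg_of_le (fun i => hitProb_nonneg (hR.nonneg i) (hR.le_one i) n)
    (fun i => hitProb_le_mul (hR.le_one i) n) (hR.hasSum.summable.mul_left _)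

lemma summable_mul_pow [IsProbabilityMeasure μ] (hR : IsRequestFlow μ R p) (n : ℕ) :
    Summable fun i => p i * (1 - p i) ^ n :=
  Summable.of_nonneg_of_le
    (fun i => mul_nonneg (hR.nonneg i) (pow_nonneg (sub_nonneg.2 (hR.le_one i)) n))
    (fun i => mul_le_of_le_one_right (hR.nonneg i)
      (pow_le_one₀ (sub_nonneg.2 (hR.le_one i)) (sub_le_self _ (hR.nonneg i)))) hR.hasSum.summable

/-! ### Concentration of the number of distinct items -/

/-- The number of distinct items among `n` requests is no more spread than a Poisson variable
of the same mean. -/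
lemma lintegral_pow_card_union_recentItems_le [IsProbabilityMeasure μ]
    (hR : IsRequestFlow μ R p) {z : ℝ} (hz : 0 < z) (n : ℕ) (A : Finset ℕ+) :
    ∫⁻ ω, ENNReal.ofReal (z ^ (A ∪ recentItems (fun j => R j ω) n).card) ∂μ ≤
      ENNReal.ofReal (z ^ A.card *
        Real.exp ((z - 1) * ∑' i, if i ∈ A then 0 else hitProb (p i) n)) := by
  -- Revealing the oldest request `j` turns `A` into `insert j A`, so the induction hypothesis is
  -- needed for all sets.
  induction n generalizing A with
  | zero => simp [recentItems, hitProb]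
  | succ n ih =>
    have hsum (A : Finset ℕ+) : Summable fun i => if i ∈ A then 0 else hitProb (p i) n := by
      refine Summable.of_nonneg_of_le (fun i => ?_) (fun i => ?_) (hR.summable_hitProb n)
      · split_ifs
        exacts [le_rfl, hitProb_nonneg (hR.nonneg i) (hR.le_one i) n]
      · split_ifs
        exacts [hitProb_nonneg (hR.nonneg i) (hR.le_one i) n, le_rfl]
    set W : Finset ℕ+ → ℝ := fun A => z ^ A.card *
        Real.exp ((z - 1) * ∑' i, if i ∈ A then 0 else hitProb (p i) n) with hW
    have hW0 (A : Finset ℕ+) : 0 ≤ W A := by positivity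
    set y : ℕ+ → ℝ := fun i => if i ∈ A then 0 else (1 - p i) ^ n with hy
    have hy0 (i) : 0 ≤ y i := by
      simp only [hy]
      split_ifs
      exacts [le_rfl, pow_nonneg (sub_nonneg.2 (hR.le_one i)) n]
    have hy1 (i) : y i ≤ 1 := by
      simp only [hy]
      split_ifs
      exacts [zero_le_one, pow_le_one₀ (sub_nonneg.2 (hR.le_one i)) (sub_le_self _ (hR.nonneg i))]
    -- A new item `j` multiplies `W A` by $z e^{-(z-1)h}$ with `h = hitProb (p j) n`. Convexity of
    -- `exp` between $0$ and $-(z-1)$, together with $z e^{-(z-1)}\le1$, bounds this by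
    -- $1+(z-1)(1-h)$.
    have hstep (j : ℕ+) : W (insert j A) ≤ W A * (1 + (z - 1) * y j) := by
      by_cases hj : j ∈ A
      · simp [hy, hj]
      · have hH : (∑' i, if i ∈ insert j A then 0 else hitProb (p i) n) =
            (∑' i, if i ∈ A then 0 else hitProb (p i) n) - hitProb (p j) n := by
          rw [eq_sub_iff_add_eq, ← tsum_ite_eq j (fun i => hitProb (p i) n),
            ← (hsum _).tsum_add ((hasSum_ite_eq j (hitProb (p j) n)).summable.congr ?_)]
          · refine tsum_congr fun i => ?_
            by_cases hij : i = j
            · subst hij; simp [hj]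
            · simp [hij]
          · intro i
            by_cases hij : i = j
            · subst hij; simp
            · simp [hij]
        simp only [hW, hy, if_neg hj, Finset.card_insert_of_notMem hj, hH]
        rw [mul_sub, sub_eq_add_neg, Real.exp_add, pow_succ]
        have hq : (1 - p j) ^ n = 1 - hitProb (p j) n := by simp [hitProb]
        have h0 := hitProb_nonneg (hR.nonneg j) (hR.le_one j) n
        have h1 := hitProb_le_one (hR.le_one j) n
        rw [hq]
        generalize hitProb (p j) n = h at h0 h1
        have hconv : Real.exp (-((z - 1) * h)) ≤ (1 - h) + h * Real.exp (-(z - 1)) := by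
          have := convexOn_exp.2 (Set.mem_univ 0) (Set.mem_univ (-(z - 1))) (sub_nonneg.2 h1) h0
            (by ring)
          simp only [smul_eq_mul, mul_zero, zero_add, Real.exp_zero, mul_one] at this
          rwa [mul_neg, mul_comm h] at this
        have hze : z * Real.exp (-(z - 1)) ≤ 1 := by
          rw [Real.exp_neg, ← div_eq_mul_inv, div_le_one (Real.exp_pos _)]
          linarith [Real.add_one_le_exp (z - 1)]
        have hfin : z * Real.exp (-((z - 1) * h)) ≤ 1 + (z - 1) * (1 - h) := by
          calc z * Real.exp (-((z - 1) * h)) ≤ z * ((1 - h) + h * Real.exp (-(z - 1))) := by gcongr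
            _ = z * (1 - h) + h * (z * Real.exp (-(z - 1))) := by ring
            _ ≤ z * (1 - h) + h * 1 := by gcongr
            _ = _ := by ring
        calc z ^ A.card * z * (Real.exp ((z - 1) * ∑' i, if i ∈ A then 0 else hitProb (p i) n) *
              Real.exp (-((z - 1) * h)))
            = z ^ A.card * Real.exp ((z - 1) * ∑' i, if i ∈ A then 0 else hitProb (p i) n) *
              (z * Real.exp (-((z - 1) * h))) := by ring
          _ ≤ _ := by gcongr
    have hpy : Summable fun j => p j * y j :=
      Summable.of_nonneg_of_le (fun j => mul_nonneg (hR.nonneg j) (hy0 j))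
        (fun j => mul_le_of_le_one_right (hR.nonneg j) (hy1 j)) hR.hasSum.summable
    have hz1 (j) : 0 ≤ 1 + (z - 1) * y j := by nlinarith [hy0 j, hy1 j]
    have hsum2 : HasSum (fun j => p j * (W A * (1 + (z - 1) * y j)))
        (W A * (1 + (z - 1) * ∑' j, p j * y j)) := by
      convert! (hR.hasSum.add (hpy.hasSum.mul_left (z - 1))).mul_left (W A) using 2
      ring
    have hnext : (∑' i, if i ∈ A then 0 else hitProb (p i) (n + 1)) =
        (∑' i, if i ∈ A then 0 else hitProb (p i) n) + ∑' j, p j * y j := by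
      rw [← (hsum A).tsum_add hpy]
      refine tsum_congr fun i => ?_
      by_cases hi : i ∈ A
      · simp [hi, hy]
      · simp [hi, hy, hitProb_succ]
    calc ∫⁻ ω, ENNReal.ofReal (z ^ (A ∪ recentItems (fun j => R j ω) (n + 1)).card) ∂μ
        = ∑' j, ENNReal.ofReal (p j) *
          ∫⁻ ω, ENNReal.ofReal (z ^ (A ∪ insert j (recentItems (fun j => R j ω) n)).card) ∂μ :=
        hR.lintegral_recentItems_succ n fun S => ENNReal.ofReal (z ^ (A ∪ S).card)
      _ = ∑' j, ENNReal.ofReal (p j) *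
          ∫⁻ ω, ENNReal.ofReal (z ^ (insert j A ∪ recentItems (fun j => R j ω) n).card) ∂μ := by
        simp_rw [Finset.union_insert, Finset.insert_union]
      _ ≤ ∑' j, ENNReal.ofReal (p j * (W A * (1 + (z - 1) * y j))) := by
        refine ENNReal.tsum_le_tsum fun j => ?_
        rw [ENNReal.ofReal_mul (hR.nonneg j)]
        gcongr
        exact (ih (insert j A)).trans (ENNReal.ofReal_le_ofReal (hstep j))
      _ = ENNReal.ofReal (W A * (1 + (z - 1) * ∑' j, p j * y j)) := by
        rw [← ENNReal.ofReal_tsum_of_nonneg _ hsum2.summable, hsum2.tsum_eq]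
        exact fun j => mul_nonneg (hR.nonneg j) (mul_nonneg (hW0 A) (hz1 j))
      _ ≤ _ := by
        refine ENNReal.ofReal_le_ofReal ?_
        rw [hnext, mul_add (z - 1), Real.exp_add, ← mul_assoc]
        refine mul_le_mul_of_nonneg_left ?_ (hW0 A)
        linarith [Real.add_one_le_exp ((z - 1) * ∑' j, p j * y j)]

/-- The expected number of distinct items among `n` requests. -/
noncomputable def _root_.meanDistinct (p : ℕ+ → ℝ) (n : ℕ) : ℝ := ∑' i, hitProb (p i) n

lemma lintegral_pow_card_recentItems_le [IsProbabilityMeasure μ]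
    (hR : IsRequestFlow μ R p) {z : ℝ} (hz : 0 < z) (n : ℕ) :
    ∫⁻ ω, ENNReal.ofReal (z ^ (recentItems (fun j => R j ω) n).card) ∂μ ≤
      ENNReal.ofReal (Real.exp ((z - 1) * meanDistinct p n)) := by
  simpa [meanDistinct] using hR.lintegral_pow_card_union_recentItems_le hz n ∅

/-- Markov's inequality. Stating the event through powers of `z` covers both tails: `z > 1` gives
`card ≥ k`, and `z < 1` gives `card ≤ k`. -/
lemma measureReal_le_of_pow_le [IsProbabilityMeasure μ]
    (hR : IsRequestFlow μ R p) {z : ℝ} (hz : 0 < z) (n k : ℕ) :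
    μ.real {ω | z ^ k ≤ z ^ (recentItems (fun j => R j ω) n).card} ≤
      Real.exp ((z - 1) * meanDistinct p n - k * Real.log z) := by
  have hm := hR.measurable_recentItems_comp n fun A => ENNReal.ofReal (z ^ A.card)
  have h := mul_meas_ge_le_lintegral (μ := μ) hm (ENNReal.ofReal (z ^ k))
  have h2 := h.trans (hR.lintegral_pow_card_recentItems_le hz n)
  have hset : {ω | ENNReal.ofReal (z ^ k) ≤
      ENNReal.ofReal (z ^ (recentItems (fun j => R j ω) n).card)} =
      {ω | z ^ k ≤ z ^ (recentItems (fun j => R j ω) n).card} := by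
    ext ω
    exact ENNReal.ofReal_le_ofReal_iff (by positivity)
  rw [hset, ← ofReal_measureReal, ← ENNReal.ofReal_mul (by positivity),
    ENNReal.ofReal_le_ofReal_iff (by positivity)] at h2
  rw [Real.exp_sub, le_div_iff₀ (Real.exp_pos _), mul_comm (k : ℝ), Real.exp_mul,
    Real.exp_log hz, Real.rpow_natCast, mul_comm]
  exact h2

/-- Upper tail of the number of distinct items. -/
lemma measureReal_card_ge_le [IsProbabilityMeasure μ] (hR : IsRequestFlow μ R p) (n k : ℕ)
    (hk : 0 < k) (h : meanDistinct p n ≤ k) :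
    μ.real {ω | k ≤ (recentItems (fun j => R j ω) n).card} ≤
      Real.exp (-((k - meanDistinct p n) ^ 2 / (4 * k))) := by
  have hk0 : (0 : ℝ) < k := by exact_mod_cast hk
  -- With `z = 1 + η` and $\log(1+\eta)\ge\eta-\eta^2$, the exponent is at most
  -- $-\eta(k-m)+k\eta^2$; this `η` is its minimiser.
  obtain ⟨η, hη⟩ : ∃ η : ℝ, k - meanDistinct p n = 2 * k * η :=
    ⟨(k - meanDistinct p n) / (2 * k), by field_simp⟩
  have hη0 : 0 ≤ η := by
    have : 0 ≤ 2 * k * η := by linarith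
    exact nonneg_of_mul_nonneg_right this (by positivity)
  have hz : 0 < 1 + η := by linarith
  refine (measureReal_mono ?_).trans ((hR.measureReal_le_of_pow_le hz n k).trans ?_)
  · exact fun ω hω => pow_le_pow_right₀ (show (1 : ℝ) ≤ 1 + η by linarith) hω
  · rw [Real.exp_le_exp, hη]
    have hμ : meanDistinct p n = k - 2 * k * η := by linarith
    have hlog := Real.one_sub_inv_le_log_of_pos hz
    have hinv : (1 + η)⁻¹ ≤ 1 - η + η ^ 2 := by
      rw [inv_le_iff_one_le_mul₀ hz]
      nlinarith [pow_nonneg hη0 3]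
    have h1 : k * (η - η ^ 2) ≤ k * Real.log (1 + η) := by
      apply mul_le_mul_of_nonneg_left _ hk0.le; linarith
    have h2 : (2 * k * η) ^ 2 / (4 * k) = k * η ^ 2 := by field_simp; ring
    rw [h2, hμ]
    nlinarith

/-- Lower tail of the number of distinct items. -/
lemma measureReal_card_le_le [IsProbabilityMeasure μ] (hR : IsRequestFlow μ R p) (n k : ℕ)
    (hk : 0 < k) (h : (k : ℝ) ≤ meanDistinct p n) (h2 : meanDistinct p n ≤ 2 * k) :
    μ.real {ω | (recentItems (fun j => R j ω) n).card ≤ k} ≤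
      Real.exp (-((k - meanDistinct p n) ^ 2 / (8 * k))) := by
  have hk0 : (0 : ℝ) < k := by exact_mod_cast hk
  -- With `z = 1 - η` the exponent is at most $-\eta(m-k)+2k\eta^2$, minimised here. The assumption
  -- $m\le2k$ keeps `η ≤ 1 / 4`, where the bound on $(1-\eta)^{-1}$ holds.
  obtain ⟨η, hη⟩ : ∃ η : ℝ, meanDistinct p n - k = 4 * k * η :=
    ⟨(meanDistinct p n - k) / (4 * k), by field_simp⟩
  have hη0 : 0 ≤ η := by
    have : 0 ≤ 4 * k * η := by linarith
    exact nonneg_of_mul_nonneg_right this (by positivity)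
  have hη1 : η ≤ 1 / 4 := by
    have : k * (4 * η) ≤ k * 1 := by linarith
    have := le_of_mul_le_mul_left this hk0
    linarith
  have hz : 0 < 1 - η := by linarith
  refine (measureReal_mono ?_).trans ((hR.measureReal_le_of_pow_le hz n k).trans ?_)
  · exact fun ω hω => pow_le_pow_of_le_one hz.le (by linarith) hω
  · rw [Real.exp_le_exp]
    have hμ : meanDistinct p n = k + 4 * k * η := by linarith
    have hlog := Real.one_sub_inv_le_log_of_pos hz
    have hinv : (1 - η)⁻¹ ≤ 1 + η + 2 * η ^ 2 := by
      rw [inv_le_iff_one_le_mul₀ hz]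
      nlinarith [mul_nonneg (pow_nonneg hη0 2) (sub_nonneg.2 hη1)]
    have h1 : k * (-η - 2 * η ^ 2) ≤ k * Real.log (1 - η) := by
      apply mul_le_mul_of_nonneg_left _ hk0.le; linarith
    rw [hμ]
    have h2 : (k - (k + 4 * k * η)) ^ 2 / (8 * k) = 2 * k * η ^ 2 := by field_simp; ring
    rw [h2]
    nlinarith

/-! ### Comparison of the cost with a window, and concavity of the mean -/

/-- Bounds for the fault probability, with any number `n` of requests as a proxy for the time in
which `k` distinct items are requested. -/
lemma measureReal_mtfCost_le [IsProbabilityMeasure μ] (hR : IsRequestFlow μ R p)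
    {s : ℕ+ → ℝ≥0} (hs : ∀ i, s i = 1) (n : ℕ) {x : ℝ} (hx : 0 ≤ x) :
    μ.real {ω | ENNReal.ofReal x < mtfCost s (fun n => R n ω) 0 + 1} ≤
      ∑' i, p i * (1 - p i) ^ n +
        μ.real {ω | ⌊x⌋₊ ≤ (recentItems (fun j => R j ω) n).card} := by
  rw [← hR.measureReal_notMem_recentItems]
  refine (measureReal_mono ?_).trans (measureReal_union_le _ _)
  intro ω hω
  by_cases h : R 0 ω ∈ recentItems (fun j => R j ω) n
  · refine Or.inr ?_
    have h1 := lt_of_lt_of_le hω (mtfCost_add_one_le hs (r := fun j => R j ω) h)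
    rw [← ENNReal.ofReal_natCast, ENNReal.ofReal_lt_ofReal_iff_of_nonneg hx] at h1
    exact_mod_cast (Nat.floor_le hx).trans h1.le
  · exact Or.inl h

lemma le_measureReal_mtfCost [IsProbabilityMeasure μ] (hR : IsRequestFlow μ R p)
    {s : ℕ+ → ℝ≥0} (hs : ∀ i, s i = 1) (n : ℕ) {x : ℝ} (hx : 0 ≤ x) :
    ∑' i, p i * (1 - p i) ^ n -
        μ.real {ω | (recentItems (fun j => R j ω) n).card ≤ ⌊x⌋₊} ≤
      μ.real {ω | ENNReal.ofReal x < mtfCost s (fun n => R n ω) 0} := by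
  rw [← hR.measureReal_notMem_recentItems, sub_le_iff_le_add]
  refine (measureReal_mono ?_).trans (measureReal_union_le _ _)
  intro ω hω
  by_cases h : (recentItems (fun j => R j ω) n).card ≤ ⌊x⌋₊
  · exact Or.inr h
  · refine Or.inl (lt_of_lt_of_le ?_ (card_recentItems_le_mtfCost hs hω))
    rw [← ENNReal.ofReal_natCast, ENNReal.ofReal_lt_ofReal_iff_of_nonneg hx]
    exact (Nat.floor_lt hx).1 (not_le.1 h)

/-- The fault probability is the increment of the mean. Being decreasing, it makes the mean concave
and is therefore controlled by difference quotients. -/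
lemma meanDistinct_succ [IsProbabilityMeasure μ] (hR : IsRequestFlow μ R p) (n : ℕ) :
    meanDistinct p (n + 1) = meanDistinct p n + ∑' i, p i * (1 - p i) ^ n := by
  simp only [meanDistinct, hitProb_succ]
  exact (hR.summable_hitProb n).tsum_add (hR.summable_mul_pow n)

lemma antitone_tsum_mul_pow [IsProbabilityMeasure μ] (hR : IsRequestFlow μ R p) :
    Antitone fun n : ℕ => ∑' i, p i * (1 - p i) ^ n := by
  intro m n hmn
  refine (hR.summable_mul_pow n).tsum_le_tsum (fun i => ?_) (hR.summable_mul_pow m)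
  exact mul_le_mul_of_nonneg_left (pow_le_pow_of_le_one (sub_nonneg.2 (hR.le_one i))
    (sub_le_self _ (hR.nonneg i)) hmn) (hR.nonneg i)

lemma meanDistinct_sub_le [IsProbabilityMeasure μ] (hR : IsRequestFlow μ R p) {m n : ℕ}
    (h : m ≤ n) :
    meanDistinct p n - meanDistinct p m ≤ (n - m : ℝ) * ∑' i, p i * (1 - p i) ^ m := by
  induction n, h using Nat.le_induction with
  | base => simp
  | succ n hmn ih =>
    have := hR.antitone_tsum_mul_pow hmn
    simp only at this
    rw [hR.meanDistinct_succ]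
    push_cast
    linarith

lemma le_meanDistinct_sub [IsProbabilityMeasure μ] (hR : IsRequestFlow μ R p) {m n : ℕ}
    (h : m ≤ n) :
    (n - m : ℝ) * ∑' i, p i * (1 - p i) ^ n ≤ meanDistinct p n - meanDistinct p m := by
  induction n, h using Nat.le_induction with
  | base => simp
  | succ n hmn ih =>
    have h1 := hR.antitone_tsum_mul_pow (Nat.le_succ n)
    have h2 : (0 : ℝ) ≤ n - m := sub_nonneg.2 (by exact_mod_cast hmn)
    simp only [Nat.succ_eq_add_one] at h1
    have h3 := mul_le_mul_of_nonneg_left h1 h2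
    rw [hR.meanDistinct_succ]
    push_cast
    linarith

end IsRequestFlow

/-! ### Euler's constant as the limit of an integral -/

/-- Differentiation of the Gamma integral at $1$, where $\Gamma'(1)=-\gamma$. -/
lemma integral_exp_neg_mul_log :
    ∫ v in Set.Ioi (0 : ℝ), Real.exp (-v) * Real.log v = -Real.eulerMascheroniConstant := by
  have h1 := Complex.hasDerivAt_GammaIntegral (s := 1) (by simp)
  have h2 : HasDerivAt Complex.GammaIntegral (-Real.eulerMascheroniConstant : ℂ) 1 := by
    refine Complex.hasDerivAt_Gamma_one.congr_of_eventuallyEq ?_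
    have : IsOpen {s : ℂ | 0 < s.re} := isOpen_lt continuous_const Complex.continuous_re
    filter_upwards [this.mem_nhds (show (1 : ℂ) ∈ {s : ℂ | 0 < s.re} by simp)] with s hs
    exact (Complex.Gamma_eq_integral hs).symm
  have h3 := h1.unique h2
  have h4 : ∫ t : ℝ in Set.Ioi 0, ((t : ℂ) ^ ((1 : ℂ) - 1) * (Real.log t * Real.exp (-t))) =
      ((∫ v in Set.Ioi (0 : ℝ), Real.exp (-v) * Real.log v : ℝ) : ℂ) := by
    rw [← integral_complex_ofReal]
    refine integral_congr_ae (Eventually.of_forall fun t => ?_)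
    simp only [sub_self, Complex.cpow_zero, one_mul]
    push_cast
    ring
  rw [h4] at h3
  exact_mod_cast h3

/-- This is the dominating function used below. Since $(1+w)^\beta\le(2\beta)^\beta e^{w/2}$ and
$e^{|\log v|/2}\le v^{1/2}+v^{-1/2}$, the integrals for $\Gamma(3/2)$ and $\Gamma(1/2)$ bound it. -/
lemma integrableOn_exp_neg_mul_one_add_abs_log_rpow {β : ℝ} (hβ : 1 ≤ β) :
    IntegrableOn (fun v : ℝ => Real.exp (-v) * (1 + |Real.log v|) ^ β) (Set.Ioi 0) := by
  have hg1 := Real.GammaIntegral_convergent (s := 3 / 2) (by norm_num)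
  have hg2 := Real.GammaIntegral_convergent (s := 1 / 2) (by norm_num)
  refine ((hg1.add hg2).const_mul ((2 * β) ^ β)).mono' ?_ ?_
  · exact (by fun_prop : Measurable fun v : ℝ =>
      Real.exp (-v) * (1 + |Real.log v|) ^ β).aestronglyMeasurable
  · refine (ae_restrict_iff' measurableSet_Ioi).2 (Eventually.of_forall fun v hv => ?_)
    have hv0 : (0 : ℝ) < v := hv
    have hpos : 0 ≤ 1 + |Real.log v| := by positivity
    rw [Real.norm_of_nonneg (by positivity)]
    set w := |Real.log v| with hw
    have hw0 : 0 ≤ w := abs_nonneg _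
    have hb : 1 + w ≤ 2 * β * Real.exp (w / (2 * β)) := by
      have h := Real.add_one_le_exp (w / (2 * β))
      have h2 : 2 * β * (w / (2 * β) + 1) ≤ 2 * β * Real.exp (w / (2 * β)) := by gcongr
      have h3 : 2 * β * (w / (2 * β) + 1) = w + 2 * β := by field_simp
      linarith
    have hb2 : (1 + w) ^ β ≤ (2 * β) ^ β * Real.exp (w / 2) := by
      refine (Real.rpow_le_rpow hpos hb (by linarith)).trans_eq ?_
      rw [Real.mul_rpow (by positivity) (by positivity), ← Real.exp_mul]
      congr 2
      field_simp
    have hb3 : Real.exp (w / 2) ≤ v ^ ((3 : ℝ) / 2 - 1) + v ^ ((1 : ℝ) / 2 - 1) := by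
      rw [Real.rpow_def_of_pos hv0, Real.rpow_def_of_pos hv0]
      rcases abs_cases (Real.log v) with ⟨h, -⟩ | ⟨h, -⟩
      · have : w / 2 = Real.log v * (3 / 2 - 1) := by rw [hw, h]; ring
        rw [this]
        linarith [Real.exp_pos (Real.log v * (1 / 2 - 1))]
      · have : w / 2 = Real.log v * (1 / 2 - 1) := by rw [hw, h]; ring
        rw [this]
        linarith [Real.exp_pos (Real.log v * (3 / 2 - 1))]
    calc Real.exp (-v) * (1 + w) ^ β
        ≤ Real.exp (-v) * ((2 * β) ^ β * (v ^ ((3 : ℝ) / 2 - 1) + v ^ ((1 : ℝ) / 2 - 1))) := by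
          gcongr
          exact hb2.trans (by gcongr)
      _ = _ := by simp only [Pi.add_apply]; ring

lemma abs_rpow_sub_rpow_le {β M x y : ℝ} (hβ : 1 ≤ β) (hx0 : 0 ≤ x) (hx : x ≤ M)
    (hy0 : 0 ≤ y) (hy : y ≤ M) : |x ^ β - y ^ β| ≤ β * M ^ (β - 1) * |x - y| := by
  have h := (convex_Icc 0 M).norm_image_sub_le_of_norm_hasDerivWithin_le
    (f := fun x : ℝ => x ^ β) (f' := fun x => β * x ^ (β - 1)) (C := β * M ^ (β - 1))
    (fun z _ => (Real.hasDerivAt_rpow_const (Or.inr hβ)).hasDerivWithinAt)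
    (fun z hz => by
      have hz0 : 0 ≤ z := hz.1
      rw [Real.norm_of_nonneg (by positivity)]
      exact mul_le_mul_of_nonneg_left (Real.rpow_le_rpow hz.1 hz.2 (by linarith)) (by linarith))
    (show y ∈ Set.Icc 0 M from ⟨hy0, hy⟩) (show x ∈ Set.Icc 0 M from ⟨hx0, hx⟩)
  simpa only [Real.norm_eq_abs] using h

lemma max_sub_zero_le {b w : ℝ} (hb : 0 ≤ b) : max (b - w) 0 ≤ b + |w| :=
  max_le (by linarith [neg_abs_le w]) (by positivity)

/-- Domination uniform in `b`: the mean value bound on $[0,b+|w|]$, with $b+|w|\le b(1+|w|)$. -/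
lemma abs_max_sub_rpow_sub_div_le {β b w : ℝ} (hβ : 1 ≤ β) (hb : 1 ≤ b) :
    |(max (b - w) 0 ^ β - b ^ β) / (β * b ^ (β - 1))| ≤ (1 + |w|) ^ β := by
  have hb0 : 0 < b := by linarith
  have hw : 0 ≤ |w| := abs_nonneg w
  have h1 := abs_rpow_sub_rpow_le hβ (le_max_right (b - w) 0) (max_sub_zero_le hb0.le)
    hb0.le (show b ≤ b + |w| by linarith)
  have h2 : |max (b - w) 0 - b| ≤ |w| := by
    have : max (b - w) 0 - b = max (b - w) 0 - max b 0 := by rw [max_eq_left hb0.le]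
    rw [this]
    refine (abs_max_sub_max_le_abs _ _ _).trans ?_
    rw [sub_sub_cancel_left, abs_neg]
  have h3 : (b + |w|) ^ (β - 1) ≤ b ^ (β - 1) * (1 + |w|) ^ (β - 1) := by
    rw [← Real.mul_rpow hb0.le (by positivity)]
    exact Real.rpow_le_rpow (by positivity) (by nlinarith) (by linarith)
  have hpos : 0 < β * b ^ (β - 1) := by positivity
  rw [abs_div, abs_of_pos hpos, div_le_iff₀ hpos]
  calc _ ≤ β * (b + |w|) ^ (β - 1) * |w| := h1.trans (by gcongr)
    _ ≤ β * (b ^ (β - 1) * (1 + |w|) ^ (β - 1)) * (1 + |w|) := by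
        gcongr
        linarith
    _ = ((1 + |w|) ^ (β - 1) * (1 + |w|) ^ (1 : ℝ)) * (β * b ^ (β - 1)) := by
        rw [Real.rpow_one]; ring
    _ = _ := by rw [← Real.rpow_add (by positivity), sub_add_cancel]

/-- First order expansion of `x ↦ x ^ β` at infinity. -/
lemma tendsto_rpow_sub_rpow_div {ι : Type*} {l : Filter ι} {β a : ℝ} (hβ : 1 ≤ β)
    {x y : ι → ℝ} (hy : Tendsto y l atTop) (hxy : Tendsto (fun i => x i - y i) l (𝓝 a)) :
    Tendsto (fun i => (x i ^ β - y i ^ β) / (β * y i ^ (β - 1))) l (𝓝 a) := by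
  have hd : HasDerivAt (fun u : ℝ => u ^ β) β 1 := by
    simpa using Real.hasDerivAt_rpow_const (x := 1) (p := β) (Or.inl one_ne_zero)
  have hu : Tendsto (fun i => x i / y i) l (𝓝 1) := by
    have h0 := hxy.mul (tendsto_inv_atTop_zero.comp hy)
    have h1 := h0.add_const 1
    simp only [mul_zero, zero_add] at h1
    refine h1.congr' ?_
    filter_upwards [hy.eventually_gt_atTop 0] with i hi
    simp only [Function.comp_apply]
    field_simp
    ring
  have hs : Tendsto (fun i => dslope (fun u : ℝ => u ^ β) 1 (x i / y i)) l (𝓝 β) := by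
    have hc := (continuousAt_dslope_same.2 hd.differentiableAt).tendsto
    rw [dslope_same, hd.deriv] at hc
    exact hc.comp hu
  have hp := (hs.mul hxy).div_const β
  rw [mul_div_cancel_left₀ a (by linarith : β ≠ 0)] at hp
  refine hp.congr' ?_
  filter_upwards [hy.eventually_gt_atTop 0, hu.eventually (lt_mem_nhds zero_lt_one)] with i hi hui
  have hxi : 0 < x i := by
    have := mul_pos hui hi
    rwa [div_mul_cancel₀ _ hi.ne'] at this
  have key := sub_smul_dslope (fun u : ℝ => u ^ β) 1 (x i / y i)
  simp only [Real.one_rpow, smul_eq_mul, Real.div_rpow hxi.le hi.le] at key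
  have hyb : y i ^ β = y i ^ (β - 1) * y i := by
    rw [← Real.rpow_add_one hi.ne', sub_add_cancel]
  have e1 : (x i - y i) = (x i / y i - 1) * y i := by field_simp
  have e2 : x i ^ β - y i ^ β = (x i ^ β / y i ^ β - 1) * y i ^ β := by
    field_simp
  rw [e1, e2, ← key, hyb]
  field_simp

/-- The source of $\gamma$: by dominated convergence the integrand tends to $-e^{-v}\log v$. -/
lemma tendsto_integral_exp_neg_mul_rpow {β : ℝ} (hβ : 1 ≤ β) :
    Tendsto (fun b : ℝ => ∫ v in Set.Ioi (0 : ℝ),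
      Real.exp (-v) * ((max (b - Real.log v) 0 ^ β - b ^ β) / (β * b ^ (β - 1))))
      atTop (𝓝 Real.eulerMascheroniConstant) := by
  have hγ : Real.eulerMascheroniConstant =
      ∫ v in Set.Ioi (0 : ℝ), Real.exp (-v) * (-Real.log v) := by
    have := integral_exp_neg_mul_log
    simp only [mul_neg, integral_neg, this, neg_neg]
  rw [hγ]
  refine tendsto_integral_filter_of_dominated_convergence
    (fun v : ℝ => Real.exp (-v) * (1 + |Real.log v|) ^ β) ?_ ?_
    (integrableOn_exp_neg_mul_one_add_abs_log_rpow hβ) ?_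
  · refine Eventually.of_forall fun b => ?_
    exact (by fun_prop : Measurable fun v : ℝ => Real.exp (-v) *
      ((max (b - Real.log v) 0 ^ β - b ^ β) / (β * b ^ (β - 1)))).aestronglyMeasurable
  · filter_upwards [eventually_ge_atTop 1] with b hb
    refine Eventually.of_forall fun v => ?_
    rw [norm_mul, Real.norm_eq_abs (Real.exp _), abs_of_pos (Real.exp_pos _), Real.norm_eq_abs]
    gcongr
    exact abs_max_sub_rpow_sub_div_le hβ hb
  · refine Eventually.of_forall fun v => Tendsto.const_mul _ ?_
    refine tendsto_rpow_sub_rpow_div hβ tendsto_id ?_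
    refine tendsto_const_nhds.congr' ?_
    filter_upwards [eventually_ge_atTop (Real.log v)] with b hb
    rw [max_eq_left (by linarith)]
    simp

/-! ### The Poissonized mean -/

lemma tsum_pnat_ite_lt (B : ℝ) :
    ∑' i : ℕ+, (if (i : ℝ) < B then (1 : ℝ≥0∞) else 0) = ((⌈B⌉₊ - 1 : ℕ) : ℝ≥0∞) := by
  rw [← Equiv.pnatEquivNat.symm.tsum_eq, tsum_eq_sum (s := Finset.range (⌈B⌉₊ - 1))]
  · rw [Finset.sum_congr rfl (g := fun _ => 1)]
    · simp
    · intro i hi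
      rw [if_pos]
      rw [← Nat.lt_ceil]
      simp only [Equiv.pnatEquivNat_symm_apply, Nat.succPNat_coe]
      have := Finset.mem_range.1 hi
      omega
  · intro i hi
    rw [if_neg]
    rw [← Nat.lt_ceil]
    simp only [Equiv.pnatEquivNat_symm_apply, Nat.succPNat_coe]
    have := Finset.mem_range.not.1 hi
    omega

lemma lintegral_Ioi_ite_exp_neg {y : ℝ} (hy : 0 ≤ y) :
    ∫⁻ v in Set.Ioi (0 : ℝ), (if v < y then ENNReal.ofReal (Real.exp (-v)) else 0) =
      ENNReal.ofReal (1 - Real.exp (-y)) := by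
  have h1 : ∀ v : ℝ, (if v < y then ENNReal.ofReal (Real.exp (-v)) else 0) =
      (Set.Iio y).indicator (fun v => ENNReal.ofReal (Real.exp (-v))) v := by
    intro v; simp [Set.indicator_apply]
  simp_rw [h1]
  rw [lintegral_indicator measurableSet_Iio, Measure.restrict_restrict measurableSet_Iio,
    Set.inter_comm, Set.Ioi_inter_Iio, ← ofReal_integral_eq_lintegral_ofReal]
  · rw [← integral_Ioc_eq_integral_Ioo, ← intervalIntegral.integral_of_le hy]
    congr 1
    rw [intervalIntegral.integral_comp_neg fun v => Real.exp v]
    simp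
  · exact ((by fun_prop : Continuous fun v : ℝ => Real.exp (-v)).integrableOn_Icc
      (a := 0) (b := y)).mono_set Set.Ioo_subset_Icc_self
  · exact Eventually.of_forall fun v => (Real.exp_pos _).le

lemma lt_exp_sub_rpow_iff {ξ b v : ℝ} (hξ : 0 < ξ) (hv : 0 < v) {i : ℝ} (hi : 0 < i) :
    v < Real.exp (b - i ^ ξ) ↔ i < max (b - Real.log v) 0 ^ (1 / ξ) := by
  rw [← Real.log_lt_iff_lt_exp hv, one_div]
  have hi2 : 0 < i ^ ξ := by positivity
  rw [Real.lt_rpow_inv_iff_of_pos hi.le (le_max_right _ _) hξ, lt_max_iff]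
  constructor
  · intro h; left; linarith
  · rintro (h | h) <;> linarith

/-- The expected number of distinct items under Poisson requests at the rates
`exp (b - i ^ ξ)`. -/
noncomputable def poissonMean (ξ b : ℝ) : ℝ :=
  ∑' i : ℕ+, (1 - Real.exp (-Real.exp (b - (i : ℝ) ^ ξ)))

/-- Write $1-e^{-y}=\int_0^\infty e^{-v}1_{v<y}\,dv$, exchange sum and integral, and count the $i$
with $i^\xi<b-\log v$. Working in `ℝ≥0∞` requires no summability beforehand. -/
lemma tsum_ofReal_poisson_eq {ξ : ℝ} (hξ : 0 < ξ) (b : ℝ) :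
    ∑' i : ℕ+, ENNReal.ofReal (1 - Real.exp (-Real.exp (b - (i : ℝ) ^ ξ))) =
      ∫⁻ v in Set.Ioi (0 : ℝ), ENNReal.ofReal (Real.exp (-v)) *
        ((⌈max (b - Real.log v) 0 ^ (1 / ξ)⌉₊ - 1 : ℕ) : ℝ≥0∞) := by
  simp_rw [← lintegral_Ioi_ite_exp_neg (Real.exp_pos _).le, ← tsum_pnat_ite_lt]
  rw [← lintegral_tsum]
  · refine setLIntegral_congr_fun measurableSet_Ioi fun v hv => ?_
    rw [← ENNReal.tsum_mul_left]
    refine tsum_congr fun i => ?_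
    simp only [lt_exp_sub_rpow_iff hξ hv (show (0 : ℝ) < i by exact_mod_cast i.pos), mul_ite,
      mul_one, mul_zero]
  · intro i
    refine (Measurable.ite measurableSet_Iio ?_ measurable_const).aemeasurable
    fun_prop

lemma integrableOn_exp_neg_mul_max_rpow {β b : ℝ} (hβ : 1 ≤ β) (hb : 1 ≤ b) :
    IntegrableOn (fun v : ℝ => Real.exp (-v) * max (b - Real.log v) 0 ^ β) (Set.Ioi 0) := by
  refine ((integrableOn_exp_neg_mul_one_add_abs_log_rpow hβ).const_mul (b ^ β)).mono' ?_ ?_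
  · exact (by fun_prop : Measurable fun v : ℝ =>
      Real.exp (-v) * max (b - Real.log v) 0 ^ β).aestronglyMeasurable
  · refine Eventually.of_forall fun v => ?_
    have h0 := le_max_right (b - Real.log v) 0
    have hw := abs_nonneg (Real.log v)
    rw [Real.norm_of_nonneg (by positivity), mul_left_comm, ← Real.mul_rpow (by linarith)
      (by positivity)]
    gcongr
    exact (max_sub_zero_le (by linarith)).trans (by nlinarith)

lemma integrableOn_exp_neg : IntegrableOn (fun v : ℝ => Real.exp (-v)) (Set.Ioi 0) :=
  integrableOn_exp_neg_Ioi 0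

/-- The count `⌈B⌉₊ - 1` lies within one of `B`, and $\int_0^\infty e^{-v}\,dv=1$, so rounding costs
at most $1$. -/
lemma summable_and_poissonMean_bounds {ξ b : ℝ} (hξ : 0 < ξ) (hξ1 : ξ ≤ 1) (hb : 1 ≤ b) :
    Summable (fun i : ℕ+ => 1 - Real.exp (-Real.exp (b - (i : ℝ) ^ ξ))) ∧
    poissonMean ξ b ≤ ∫ v in Set.Ioi (0 : ℝ), Real.exp (-v) * max (b - Real.log v) 0 ^ (1 / ξ) ∧
    (∫ v in Set.Ioi (0 : ℝ), Real.exp (-v) * max (b - Real.log v) 0 ^ (1 / ξ)) - 1 ≤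
      poissonMean ξ b := by
  have hβ : 1 ≤ 1 / ξ := by rw [le_div_iff₀ hξ]; linarith
  have hint := integrableOn_exp_neg_mul_max_rpow hβ hb
  have hnn (i : ℕ+) : 0 ≤ 1 - Real.exp (-Real.exp (b - (i : ℝ) ^ ξ)) := by
    rw [sub_nonneg, Real.exp_le_one_iff, neg_nonpos]; positivity
  have hB0 (v : ℝ) : 0 ≤ max (b - Real.log v) 0 ^ (1 / ξ) :=
    Real.rpow_nonneg (le_max_right _ _) _
  have hI0 : 0 ≤ ∫ v in Set.Ioi (0 : ℝ), Real.exp (-v) * max (b - Real.log v) 0 ^ (1 / ξ) :=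
    integral_nonneg fun v => mul_nonneg (Real.exp_pos _).le (hB0 v)
  have hle : ∑' i : ℕ+, ENNReal.ofReal (1 - Real.exp (-Real.exp (b - (i : ℝ) ^ ξ))) ≤
      ENNReal.ofReal
        (∫ v in Set.Ioi (0 : ℝ), Real.exp (-v) * max (b - Real.log v) 0 ^ (1 / ξ)) := by
    rw [tsum_ofReal_poisson_eq hξ, ofReal_integral_eq_lintegral_ofReal hint
      (Eventually.of_forall fun v => mul_nonneg (Real.exp_pos _).le (hB0 v))]
    refine lintegral_mono fun v => ?_
    rw [ENNReal.ofReal_mul (Real.exp_pos _).le]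
    gcongr
    rw [← ENNReal.ofReal_natCast]
    refine ENNReal.ofReal_le_ofReal ?_
    have := Nat.ceil_lt_add_one (hB0 v)
    rcases Nat.eq_zero_or_pos ⌈max (b - Real.log v) 0 ^ (1 / ξ)⌉₊ with h | h
    · rw [h]; simpa using hB0 v
    · rw [Nat.cast_sub h]; push_cast; linarith
  have hsum : Summable (fun i : ℕ+ => 1 - Real.exp (-Real.exp (b - (i : ℝ) ^ ξ))) := by
    have := ENNReal.summable_toReal (ne_top_of_le_ne_top ENNReal.ofReal_ne_top hle)
    exact this.congr fun i => by rw [ENNReal.toReal_ofReal (hnn i)]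
  have heq := ENNReal.ofReal_tsum_of_nonneg hnn hsum
  refine ⟨hsum, ?_, ?_⟩
  · rw [← heq] at hle
    exact (ENNReal.ofReal_le_ofReal_iff hI0).1 hle
  · have h1 : (∫⁻ v in Set.Ioi (0 : ℝ), ENNReal.ofReal (Real.exp (-v))) = 1 := by
      rw [← ofReal_integral_eq_lintegral_ofReal integrableOn_exp_neg
        (Eventually.of_forall fun v => (Real.exp_pos _).le), integral_exp_neg_Ioi_zero,
        ENNReal.ofReal_one]
    rw [sub_le_iff_le_add, poissonMean,
      ← ENNReal.ofReal_le_ofReal_iff (add_nonneg (tsum_nonneg hnn) zero_le_one),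
      ENNReal.ofReal_add (tsum_nonneg hnn) zero_le_one, heq,
      tsum_ofReal_poisson_eq hξ, ofReal_integral_eq_lintegral_ofReal hint
      (Eventually.of_forall fun v => mul_nonneg (Real.exp_pos _).le (hB0 v)),
      ENNReal.ofReal_one, ← h1, ← lintegral_add_right _ (by fun_prop)]
    refine lintegral_mono fun v => ?_
    rw [ENNReal.ofReal_mul (Real.exp_pos _).le, ← mul_add_one]
    gcongr
    rw [← ENNReal.ofReal_natCast, ← ENNReal.ofReal_one, ← ENNReal.ofReal_add (by positivity)
      zero_le_one]
    refine ENNReal.ofReal_le_ofReal ?_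
    have h2 := Nat.le_ceil (max (b - Real.log v) 0 ^ (1 / ξ))
    have h3 : (⌈max (b - Real.log v) 0 ^ (1 / ξ)⌉₊ : ℝ) ≤
        ((⌈max (b - Real.log v) 0 ^ (1 / ξ)⌉₊ - 1 : ℕ) : ℝ) + 1 := by
      have : ⌈max (b - Real.log v) 0 ^ (1 / ξ)⌉₊ ≤
        ⌈max (b - Real.log v) 0 ^ (1 / ξ)⌉₊ - 1 + 1 := by omega
      exact_mod_cast this
    exact h2.trans h3

lemma tendsto_poissonMean {ξ : ℝ} (hξ : 0 < ξ) (hξ1 : ξ < 1) :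
    Tendsto (fun b : ℝ => (poissonMean ξ b - b ^ (1 / ξ)) / (1 / ξ * b ^ (1 / ξ - 1)))
      atTop (𝓝 Real.eulerMascheroniConstant) := by
  have hβ : 1 < 1 / ξ := by rw [lt_div_iff₀ hξ]; linarith
  have hmain := tendsto_integral_exp_neg_mul_rpow hβ.le
  have hden : Tendsto (fun b : ℝ => 1 / ξ * b ^ (1 / ξ - 1)) atTop atTop :=
    (tendsto_rpow_atTop (by linarith)).const_mul_atTop (by positivity)
  have heq : ∀ᶠ b : ℝ in atTop, (∫ v in Set.Ioi (0 : ℝ), Real.exp (-v) *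
      ((max (b - Real.log v) 0 ^ (1 / ξ) - b ^ (1 / ξ)) / (1 / ξ * b ^ (1 / ξ - 1)))) =
      ((∫ v in Set.Ioi (0 : ℝ), Real.exp (-v) * max (b - Real.log v) 0 ^ (1 / ξ)) -
        b ^ (1 / ξ)) / (1 / ξ * b ^ (1 / ξ - 1)) := by
    filter_upwards [eventually_ge_atTop 1] with b hb
    simp_rw [← mul_div_assoc, mul_sub]
    rw [integral_div, integral_sub (integrableOn_exp_neg_mul_max_rpow hβ.le hb)
      (integrableOn_exp_neg.mul_const _), integral_mul_const, integral_exp_neg_Ioi_zero, one_mul]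
  have hup := hmain.congr' heq
  have hlow := hup.sub (tendsto_inv_atTop_zero.comp hden)
  rw [sub_zero] at hlow
  refine tendsto_of_tendsto_of_tendsto_of_le_of_le' hlow hup ?_ ?_
  · filter_upwards [eventually_ge_atTop 1] with b hb
    have h := (summable_and_poissonMean_bounds hξ hξ1.le hb).2.2
    have hpos : 0 < 1 / ξ * b ^ (1 / ξ - 1) := by
      have : 0 < b := by linarith
      positivity
    simp only [Function.comp_apply]
    rw [inv_eq_one_div, ← sub_div]
    exact div_le_div_of_nonneg_right (by linarith) hpos.le
  · filter_upwards [eventually_ge_atTop 1] with b hb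
    have h := (summable_and_poissonMean_bounds hξ hξ1.le hb).2.1
    have : 0 < b := by linarith
    gcongr

/-! ### Tail sums -/

/-- Tail sums inherit asymptotic equivalence with a telescoping sequence. -/
lemma isEquivalent_tsum_tail {u g : ℕ → ℝ} (hu : Summable u) (hg : Tendsto g atTop (𝓝 0))
    (hd : ∀ᶠ j in atTop, g (j + 1) ≤ g j) (h : u ~[atTop] fun j => g j - g (j + 1)) :
    (fun k => ∑' j, u (k + j)) ~[atTop] g := by
  rw [IsEquivalent, isLittleO_iff] at h ⊢
  intro ε hε
  filter_upwards [eventually_forall_ge_atTop.2 (h hε), eventually_forall_ge_atTop.2 hd] with k hk hdk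
  have hsum : HasSum (fun j => g (k + j) - g (k + j + 1)) (g k) := by
    rw [hasSum_iff_tendsto_nat_of_nonneg fun j => sub_nonneg.2 (hdk _ (Nat.le_add_right k j))]
    have h1 : ∀ n, ∑ j ∈ Finset.range n, (g (k + j) - g (k + j + 1)) = g k - g (k + n) := fun n =>
      Finset.sum_range_sub' (fun j => g (k + j)) n
    simp_rw [h1]
    have h2 : Tendsto (fun n => g (k + n)) atTop (𝓝 0) := by
      simp_rw [add_comm k]
      exact (tendsto_add_atTop_iff_nat k).2 hg
    simpa using h2.const_sub (g k)
  have hu' : HasSum (fun j => u (k + j)) (∑' j, u (k + j)) := by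
    simp_rw [add_comm k]
    exact ((summable_nat_add_iff k).2 hu).hasSum
  have hg0 : 0 ≤ g k := hsum.nonneg fun j => sub_nonneg.2 (hdk _ (Nat.le_add_right k j))
  have hb (j : ℕ) : |u (k + j) - (g (k + j) - g (k + j + 1))| ≤
      ε * (g (k + j) - g (k + j + 1)) := by
    have := hk (k + j) (Nat.le_add_right k j)
    simp only [Pi.sub_apply, Real.norm_eq_abs] at this
    rwa [abs_of_nonneg (sub_nonneg.2 (hdk _ (Nat.le_add_right k j)))] at this
  rw [Pi.sub_apply, Real.norm_eq_abs, Real.norm_of_nonneg hg0, abs_le]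
  constructor
  · rw [← neg_mul]
    exact hasSum_le (fun j => by rw [neg_mul]; exact (abs_le.1 (hb j)).1) (hsum.mul_left (-ε))
      (hu'.sub hsum)
  · exact hasSum_le (fun j => (abs_le.1 (hb j)).2) (hu'.sub hsum) (hsum.mul_left ε)

/-- The asymptotic form of `∫ t in Ioi y, exp (-t ^ ξ)`. -/
noncomputable def stretchedTail (ξ y : ℝ) : ℝ := 1 / ξ * y ^ (1 - ξ) * Real.exp (-y ^ ξ)

lemma hasDerivAt_stretchedTail {ξ y : ℝ} (hξ : 0 < ξ) (hy : 0 < y) :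
    HasDerivAt (stretchedTail ξ) (-(Real.exp (-y ^ ξ) * (1 - (1 - ξ) / ξ * y ^ (-ξ)))) y := by
  have h1 := (Real.hasDerivAt_rpow_const (x := y) (p := 1 - ξ) (Or.inl hy.ne')).const_mul (1 / ξ)
  have h2 := (Real.hasDerivAt_rpow_const (x := y) (p := ξ) (Or.inl hy.ne')).neg.exp
  refine (h1.mul h2).congr_deriv ?_
  have h3 : y ^ (1 - ξ) * y ^ (ξ - 1) = 1 := by
    rw [← Real.rpow_add hy]; simp
  have h4 : 1 - ξ - 1 = -ξ := by ring
  rw [h4]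
  have h5 : 1 / ξ * ξ = 1 := by field_simp
  simp only [Pi.neg_apply]
  linear_combination (-Real.exp (-y ^ ξ) * (1 / ξ * ξ)) * h3 - Real.exp (-y ^ ξ) * h5

lemma tendsto_natCast_rpow_atTop {ξ : ℝ} (hξ : 0 < ξ) :
    Tendsto (fun k : ℕ => (k : ℝ) ^ ξ) atTop atTop :=
  (tendsto_rpow_atTop hξ).comp tendsto_natCast_atTop_atTop

lemma tendsto_stretchedTail {ξ : ℝ} (hξ : 0 < ξ) :
    Tendsto (stretchedTail ξ) atTop (𝓝 0) := by
  have h := ((tendsto_rpow_mul_exp_neg_mul_atTop_nhds_zero ((1 - ξ) / ξ) 1 one_pos).comp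
    (tendsto_rpow_atTop hξ)).const_mul (1 / ξ)
  rw [mul_zero] at h
  refine h.congr' ?_
  filter_upwards [eventually_gt_atTop 0] with y hy
  simp only [Function.comp_apply, stretchedTail]
  rw [← Real.rpow_mul hy.le, mul_div_cancel₀ _ hξ.ne', neg_one_mul, mul_assoc]

lemma tendsto_succ_rpow_sub_rpow {ξ : ℝ} (hξ : 0 < ξ) (hξ1 : ξ < 1) :
    Tendsto (fun k : ℕ => ((k : ℝ) + 1) ^ ξ - (k : ℝ) ^ ξ) atTop (𝓝 0) := by
  have h := ((tendsto_rpow_neg_atTop (show 0 < 1 - ξ by linarith)).comp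
    (tendsto_natCast_atTop_atTop (R := ℝ))).const_mul ξ
  rw [mul_zero] at h
  refine squeeze_zero' ?_ ?_ h
  · refine Eventually.of_forall fun k => sub_nonneg.2 ?_
    exact Real.rpow_le_rpow (by positivity) (by linarith) hξ.le
  · filter_upwards [eventually_gt_atTop 0] with k hk
    have hk0 : (0 : ℝ) < k := by exact_mod_cast hk
    have h1 : ((k : ℝ) + 1) ^ ξ = (k : ℝ) ^ ξ * (1 + 1 / k) ^ ξ := by
      rw [← Real.mul_rpow hk0.le (by positivity)]
      congr 1
      field_simp
    have h2 := rpow_one_add_le_one_add_mul_self (s := 1 / (k : ℝ))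
      (by have : (0 : ℝ) ≤ 1 / k := by positivity
          linarith) hξ.le hξ1.le
    have h3 : (k : ℝ) ^ (-(1 - ξ)) = (k : ℝ) ^ ξ * (1 / k) := by
      rw [neg_sub, Real.rpow_sub_one hk0.ne', mul_one_div]
    simp only [Function.comp_apply]
    rw [h1, h3]
    have := mul_le_mul_of_nonneg_left h2 (Real.rpow_nonneg hk0.le ξ)
    linarith

/-- By the mean value theorem the difference is $e^{-y^\xi}(1+o(1))$ for some $y\in(k,k+1)$; moving
$y$ to $k+1$ changes the exponent by $o(1)$, since $\xi<1$. -/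
lemma isEquivalent_stretchedTail_sub {ξ : ℝ} (hξ : 0 < ξ) (hξ1 : ξ < 1) :
    (fun k : ℕ => Real.exp (-((k : ℝ) + 1) ^ ξ)) ~[atTop]
      fun k : ℕ => stretchedTail ξ k - stretchedTail ξ (k + 1 : ℕ) := by
  have hmvt (k : ℕ) : ∃ y : ℝ, 0 < k → (k : ℝ) < y ∧ y < k + 1 ∧
      stretchedTail ξ k - stretchedTail ξ (k + 1 : ℕ) =
        Real.exp (-y ^ ξ) * (1 - (1 - ξ) / ξ * y ^ (-ξ)) := by
    by_cases hk : 0 < k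
    · have hk0 : (0 : ℝ) < k := by exact_mod_cast hk
      obtain ⟨y, hy, hy2⟩ := exists_hasDerivAt_eq_slope (stretchedTail ξ)
        (fun y => -(Real.exp (-y ^ ξ) * (1 - (1 - ξ) / ξ * y ^ (-ξ)))) (lt_add_one (k : ℝ))
        (fun y hy => (hasDerivAt_stretchedTail hξ
          (lt_of_lt_of_le hk0 hy.1)).continuousAt.continuousWithinAt)
        (fun y hy => hasDerivAt_stretchedTail hξ (hk0.trans hy.1))
      refine ⟨y, fun _ => ⟨hy.1, hy.2, ?_⟩⟩
      simp only [add_sub_cancel_left, div_one] at hy2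
      push_cast
      linarith
    · exact ⟨0, fun h => absurd h hk⟩
  choose y hy using hmvt
  have hy_top : Tendsto y atTop atTop := by
    refine tendsto_atTop_mono' _ ?_ (tendsto_natCast_atTop_atTop (R := ℝ))
    filter_upwards [eventually_gt_atTop 0] with k hk using (hy k hk).1.le
  have h1 : Tendsto (fun k => 1 - (1 - ξ) / ξ * (y k) ^ (-ξ)) atTop (𝓝 1) := by
    have := (((tendsto_rpow_neg_atTop hξ).comp hy_top).const_mul ((1 - ξ) / ξ)).const_sub 1
    simpa using this
  have h2 : Tendsto (fun k : ℕ => ((k : ℝ) + 1) ^ ξ - (y k) ^ ξ) atTop (𝓝 0) := by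
    refine squeeze_zero' ?_ ?_ (tendsto_succ_rpow_sub_rpow hξ hξ1)
    · filter_upwards [eventually_gt_atTop 0] with k hk
      have hk0 : (0 : ℝ) < k := by exact_mod_cast hk
      obtain ⟨ha, hb, -⟩ := hy k hk
      exact sub_nonneg.2 (Real.rpow_le_rpow (by linarith) hb.le hξ.le)
    · filter_upwards [eventually_gt_atTop 0] with k hk
      have hk0 : (0 : ℝ) < k := by exact_mod_cast hk
      obtain ⟨ha, hb, -⟩ := hy k hk
      exact sub_le_sub_left (Real.rpow_le_rpow hk0.le ha.le hξ.le) _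
  have h3 : Tendsto (fun k : ℕ => Real.exp (((k : ℝ) + 1) ^ ξ - (y k) ^ ξ) *
      (1 - (1 - ξ) / ξ * (y k) ^ (-ξ))) atTop (𝓝 1) := by
    have := ((Real.continuous_exp.tendsto 0).comp h2).mul h1
    simpa using this
  refine IsEquivalent.symm ?_
  refine (isEquivalent_iff_tendsto_one (Eventually.of_forall fun k => (Real.exp_pos _).ne')).2 ?_
  refine h3.congr' ?_
  filter_upwards [eventually_gt_atTop 0] with k hk
  rw [Pi.div_apply, (hy k hk).2.2, eq_div_iff (Real.exp_pos _).ne', mul_right_comm, ← Real.exp_add]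
  congr 2
  ring

/-- The tail of a stretched exponential law. -/
lemma isEquivalent_tail {p : ℕ+ → ℝ} (hsum : Summable p) {c ξ : ℝ}
    (hξ : 0 < ξ) (hξ1 : ξ < 1) (hp : p ~[atTop] fun i : ℕ+ => c * Real.exp (-((i : ℝ) ^ ξ)))
    (hc : 0 < c) :
    (fun k : ℕ => ∑' j : ℕ, p (k + j).succPNat) ~[atTop] fun k : ℕ => c * stretchedTail ξ k := by
  have hinj : Function.Injective Nat.succPNat := Nat.succPNat_injective
  have htop : Tendsto Nat.succPNat atTop atTop :=
    tendsto_atTop_atTop_of_monotone Nat.succPNat_mono fun b =>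
      ⟨b, by rw [← PNat.coe_le_coe, Nat.succPNat_coe]; exact Nat.le_succ _⟩
  have hsub := isEquivalent_stretchedTail_sub hξ hξ1
  have hequiv : (fun k : ℕ => p k.succPNat) ~[atTop]
      fun k : ℕ => c * stretchedTail ξ k - c * stretchedTail ξ (k + 1 : ℕ) := by
    have h1 := hp.comp_tendsto htop
    have h2 := (IsEquivalent.refl (u := fun _ : ℕ => c) (l := atTop)).mul hsub
    refine (h1.trans (h2.congr_left ?_)).congr_right ?_
    · exact Eventually.of_forall fun k => by simp
    · exact Eventually.of_forall fun k => by simp [mul_sub]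
  refine isEquivalent_tsum_tail (hsum.comp_injective hinj) ?_ ?_ hequiv
  · have := ((tendsto_stretchedTail hξ).comp (tendsto_natCast_atTop_atTop (R := ℝ))).const_mul c
    simpa using this
  · filter_upwards [hsub.symm.eventually_pos (Eventually.of_forall fun k => Real.exp_pos _)]
      with k hk
    have := mul_pos hc hk
    linarith

/-! ### The mean number of distinct items -/

/-- Used for the finitely many small items, where the asymptotics of `p` say nothing and each
summand errs by at most $1$. -/
lemma tsum_le_tsum_add_card {ι : Type*} {f g : ι → ℝ} (hf : Summable f) (hg : Summable g)
    (s : Finset ι) (hs : ∀ i ∈ s, f i ≤ g i + 1) (hns : ∀ i ∉ s, f i ≤ g i) :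
    ∑' i, f i ≤ ∑' i, g i + s.card := by
  classical
  have h1 : HasSum (fun i => if i ∈ s then (1 : ℝ) else 0) s.card := by
    have : HasSum (fun i => if i ∈ s then (1 : ℝ) else 0) _ := hasSum_sum_of_ne_finset_zero (s := s)
      (fun i hi => if_neg hi)
    simpa [Finset.sum_ite_mem] using this
  refine hasSum_le (fun i => ?_) hf.hasSum (hg.hasSum.add h1)
  by_cases hi : i ∈ s
  · simpa [hi] using hs i hi
  · simpa [hi] using hns i hi

/-- For $b=k^\xi+a$, $b^{1/\xi}=k+(a+o(1))k^{1-\xi}/\xi$: the shift adds `a` to $\gamma$. -/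
lemma tendsto_poissonMean_natCast_rpow {ξ : ℝ} (hξ : 0 < ξ) (hξ1 : ξ < 1) (a : ℝ) :
    Tendsto (fun k : ℕ => (poissonMean ξ ((k : ℝ) ^ ξ + a) - k) / (1 / ξ * (k : ℝ) ^ (1 - ξ)))
      atTop (𝓝 (Real.eulerMascheroniConstant + a)) := by
  have hβ : 1 < 1 / ξ := by rw [lt_div_iff₀ hξ]; linarith
  have hy := tendsto_natCast_rpow_atTop hξ
  have hx : Tendsto (fun k : ℕ => (k : ℝ) ^ ξ + a) atTop atTop := tendsto_atTop_add_const_right _ _ hy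
  have h1 := (tendsto_poissonMean hξ hξ1).comp hx
  have h2 : Tendsto (fun k : ℕ => (((k : ℝ) ^ ξ + a) ^ (1 / ξ) - ((k : ℝ) ^ ξ) ^ (1 / ξ)) /
      (1 / ξ * ((k : ℝ) ^ ξ) ^ (1 / ξ - 1))) atTop (𝓝 a) :=
    tendsto_rpow_sub_rpow_div hβ.le hy (by simp)
  have h3 : Tendsto (fun k : ℕ => (((k : ℝ) ^ ξ + a) / (k : ℝ) ^ ξ) ^ (1 / ξ - 1)) atTop (𝓝 1) := by
    have h4 : Tendsto (fun k : ℕ => ((k : ℝ) ^ ξ + a) / (k : ℝ) ^ ξ) atTop (𝓝 1) := by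
      have h5 := ((tendsto_inv_atTop_zero.comp hy).const_mul a).const_add 1
      simp only [mul_zero, add_zero] at h5
      refine h5.congr' ?_
      filter_upwards [hy.eventually_gt_atTop 0] with k hk
      simp only [Function.comp_apply]
      field_simp
    have h6 := h4.rpow_const (p := 1 / ξ - 1) (Or.inl one_ne_zero)
    simpa using h6
  have h7 := (h1.mul h3).add h2
  rw [mul_one] at h7
  refine h7.congr' ?_
  filter_upwards [hy.eventually_gt_atTop 0, hx.eventually_gt_atTop 0] with k hk hkx
  have e1 : ((k : ℝ) ^ ξ) ^ (1 / ξ) = k := by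
    rw [← Real.rpow_mul (by positivity), mul_one_div_cancel hξ.ne', Real.rpow_one]
  have e2 : ((k : ℝ) ^ ξ) ^ (1 / ξ - 1) = (k : ℝ) ^ (1 - ξ) := by
    rw [← Real.rpow_mul (by positivity), mul_sub, mul_one_div_cancel hξ.ne', mul_one]
  simp only [Function.comp_apply]
  rw [Real.div_rpow hkx.le hk.le, e1, e2]
  have e3 : (k : ℝ) ^ (1 - ξ) ≠ 0 := by rw [← e2]; positivity
  have e4 : ((k : ℝ) ^ ξ + a) ^ (1 / ξ - 1) ≠ 0 := by positivity
  field_simp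
  ring

lemma tendsto_floor_exp_div {c : ℝ} (hc : 0 < c) {ξ : ℝ} (hξ : 0 < ξ) (a : ℝ) :
    Tendsto (fun k : ℕ => (⌊Real.exp ((k : ℝ) ^ ξ + a) / c⌋₊ : ℝ) *
      (c * Real.exp (-((k : ℝ) ^ ξ)))) atTop (𝓝 (Real.exp a)) := by
  have hx : Tendsto (fun k : ℕ => Real.exp ((k : ℝ) ^ ξ + a) / c) atTop atTop :=
    (Real.tendsto_exp_atTop.comp (tendsto_atTop_add_const_right _ _
      (tendsto_natCast_rpow_atTop hξ))).atTop_div_const hc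
  have h := (tendsto_nat_floor_div_atTop (R := ℝ)).comp hx
  have h2 := h.mul_const (Real.exp a)
  rw [one_mul] at h2
  refine h2.congr fun k => ?_
  simp only [Function.comp_apply]
  rw [Real.exp_add, Real.exp_neg]
  field_simp

/-- Poissonization: $np_i$ is close to $e^{k^\xi+a-i^\xi}$. In both bounds half of `δ` pays for
$p_i\sim ce^{-i^\xi}$; the other half pays for $1-p_i$ against an exponential in the upper bound,
and for the floor in the lower one. -/
lemma eventually_meanDistinct_bounds {p : ℕ+ → ℝ} (h0 : ∀ i, 0 ≤ p i) (h1 : ∀ i, p i ≤ 1)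
    (hsum : Summable p) {c ξ : ℝ} (hc : 0 < c) (hξ : 0 < ξ) (hξ1 : ξ < 1)
    (hp : p ~[atTop] fun i : ℕ+ => c * Real.exp (-((i : ℝ) ^ ξ))) (a : ℝ) {δ : ℝ} (hδ : 0 < δ) :
    ∃ K : ℝ, ∀ᶠ k : ℕ in atTop,
      meanDistinct p ⌊Real.exp ((k : ℝ) ^ ξ + a) / c⌋₊ ≤ poissonMean ξ ((k : ℝ) ^ ξ + (a + δ)) + K ∧
      poissonMean ξ ((k : ℝ) ^ ξ + (a - δ)) ≤
        meanDistinct p ⌊Real.exp ((k : ℝ) ^ ξ + a) / c⌋₊ + K := by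
  have hpz : Tendsto p atTop (𝓝 0) := hsum.tendsto_cofinite_zero.mono_left atTop_le_cofinite
  obtain ⟨φ, hφ, hpφ⟩ := hp.exists_eq_mul
  have hev : ∀ᶠ i : ℕ+ in atTop, p i ≤ c * Real.exp (δ / 2 - (i : ℝ) ^ ξ) ∧
      c * Real.exp (-(δ / 2) - (i : ℝ) ^ ξ) ≤ p i ∧
      Real.exp (-(Real.exp (δ / 2) * p i)) ≤ 1 - p i := by
    have hδ1 : (1 : ℝ) < Real.exp (δ / 2) := Real.one_lt_exp_iff.2 (by linarith)
    have hδ2 : Real.exp (-(δ / 2)) < 1 := Real.exp_lt_one_iff.2 (by linarith)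
    filter_upwards [hφ.eventually (gt_mem_nhds hδ1), hφ.eventually (lt_mem_nhds hδ2), hpφ,
      hpz.eventually (gt_mem_nhds (sub_pos.2 hδ2))] with i hi1 hi2 hi3 hi4
    refine ⟨?_, ?_, ?_⟩
    · rw [hi3, Pi.mul_apply, sub_eq_add_neg, Real.exp_add, mul_left_comm]
      gcongr
    · rw [hi3, Pi.mul_apply, sub_eq_add_neg, Real.exp_add, mul_left_comm]
      gcongr
    · have hpos : 0 < 1 - p i := by linarith [Real.exp_pos (-(δ / 2))]
      rw [← Real.le_log_iff_exp_le hpos]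
      have hl := Real.one_sub_inv_le_log_of_pos hpos
      have hinv : (1 - p i)⁻¹ ≤ Real.exp (δ / 2) := by
        rw [inv_le_comm₀ hpos (Real.exp_pos _), ← Real.exp_neg]
        linarith
      have e : 1 - (1 - p i)⁻¹ = -((1 - p i)⁻¹ * p i) := by field_simp; ring
      have := mul_le_mul_of_nonneg_right hinv (h0 i)
      linarith
  obtain ⟨I, hI⟩ := eventually_atTop.1 hev
  refine ⟨((Finset.Iio I).card : ℝ), ?_⟩
  have hy := tendsto_natCast_rpow_atTop hξ
  have hfl := (tendsto_floor_exp_div hc hξ a).eventually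
    (lt_mem_nhds (show Real.exp (a - δ / 2) < Real.exp a from Real.exp_lt_exp.2 (by linarith)))
  filter_upwards [hfl, hy.eventually_ge_atTop (1 - (a + δ)), hy.eventually_ge_atTop (1 - (a - δ))]
    with k hk hka hkb
  set n := ⌊Real.exp ((k : ℝ) ^ ξ + a) / c⌋₊ with hn
  have hnc : n * c ≤ Real.exp ((k : ℝ) ^ ξ + a) := by
    have := Nat.floor_le (show 0 ≤ Real.exp ((k : ℝ) ^ ξ + a) / c by positivity)
    rwa [le_div_iff₀ hc] at this
  have hnc2 : Real.exp ((k : ℝ) ^ ξ + (a - δ / 2)) ≤ n * c := by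
    rw [Real.exp_add]
    have := mul_le_mul_of_nonneg_left hk.le (Real.exp_pos ((k : ℝ) ^ ξ)).le
    refine this.trans_eq ?_
    rw [Real.exp_neg]
    field_simp
  have hsh : Summable fun i => hitProb (p i) n :=
    Summable.of_nonneg_of_le (fun i => hitProb_nonneg (h0 i) (h1 i) n)
      (fun i => hitProb_le_mul (h1 i) n) (hsum.mul_left _)
  have hs1 := (summable_and_poissonMean_bounds hξ hξ1.le
    (show 1 ≤ (k : ℝ) ^ ξ + (a + δ) by linarith)).1
  have hs2 := (summable_and_poissonMean_bounds hξ hξ1.le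
    (show 1 ≤ (k : ℝ) ^ ξ + (a - δ) by linarith)).1
  have hf0 (x : ℝ) : 0 ≤ 1 - Real.exp (-Real.exp x) := by
    rw [sub_nonneg, Real.exp_le_one_iff, neg_nonpos]; positivity
  have hf1 (x : ℝ) : 1 - Real.exp (-Real.exp x) ≤ 1 := by linarith [Real.exp_pos (-Real.exp x)]
  constructor
  · refine tsum_le_tsum_add_card hsh hs1 _ (fun i _ => ?_) (fun i hi => ?_)
    · linarith [hitProb_le_one (h1 i) n, hf0 ((k : ℝ) ^ ξ + (a + δ) - (i : ℝ) ^ ξ)]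
    · obtain ⟨h2, -, h3⟩ := hI i (by simpa using hi)
      refine sub_le_sub_left ?_ 1
      calc Real.exp (-Real.exp ((k : ℝ) ^ ξ + (a + δ) - (i : ℝ) ^ ξ))
          ≤ Real.exp (n * -(Real.exp (δ / 2) * p i)) := by
            rw [Real.exp_le_exp, mul_neg, neg_le_neg_iff]
            calc (n : ℝ) * (Real.exp (δ / 2) * p i)
                ≤ n * (Real.exp (δ / 2) * (c * Real.exp (δ / 2 - (i : ℝ) ^ ξ))) := by gcongr
              _ = n * c * (Real.exp (δ / 2) * Real.exp (δ / 2 - (i : ℝ) ^ ξ)) := by ring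
              _ ≤ Real.exp ((k : ℝ) ^ ξ + a) *
                  (Real.exp (δ / 2) * Real.exp (δ / 2 - (i : ℝ) ^ ξ)) := by gcongr
              _ = _ := by rw [← Real.exp_add, ← Real.exp_add]; congr 1; ring
        _ = Real.exp (-(Real.exp (δ / 2) * p i)) ^ n := Real.exp_nat_mul _ _
        _ ≤ (1 - p i) ^ n := by gcongr
  · refine tsum_le_tsum_add_card hs2 hsh _ (fun i _ => ?_) (fun i hi => ?_)
    · linarith [hitProb_nonneg (h0 i) (h1 i) n, hf1 ((k : ℝ) ^ ξ + (a - δ) - (i : ℝ) ^ ξ)]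
    · obtain ⟨-, h2, -⟩ := hI i (by simpa using hi)
      refine sub_le_sub_left ?_ 1
      calc (1 - p i) ^ n ≤ Real.exp (-p i) ^ n := by
            refine pow_le_pow_left₀ (sub_nonneg.2 (h1 i)) ?_ n
            linarith [Real.add_one_le_exp (-p i)]
        _ = Real.exp (n * -p i) := (Real.exp_nat_mul _ _).symm
        _ ≤ _ := by
            rw [Real.exp_le_exp, mul_neg, neg_le_neg_iff]
            calc Real.exp ((k : ℝ) ^ ξ + (a - δ) - (i : ℝ) ^ ξ)
                = Real.exp ((k : ℝ) ^ ξ + (a - δ / 2)) * Real.exp (-(δ / 2) - (i : ℝ) ^ ξ) := by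
                  rw [← Real.exp_add]; congr 1; ring
              _ ≤ n * c * Real.exp (-(δ / 2) - (i : ℝ) ^ ξ) := by gcongr
              _ = n * (c * Real.exp (-(δ / 2) - (i : ℝ) ^ ξ)) := by ring
              _ ≤ n * p i := by gcongr

lemma tendsto_meanDistinct {p : ℕ+ → ℝ} (h0 : ∀ i, 0 ≤ p i) (h1 : ∀ i, p i ≤ 1)
    (hsum : Summable p) {c ξ : ℝ} (hc : 0 < c) (hξ : 0 < ξ) (hξ1 : ξ < 1)
    (hp : p ~[atTop] fun i : ℕ+ => c * Real.exp (-((i : ℝ) ^ ξ))) (a : ℝ) :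
    Tendsto (fun k : ℕ => (meanDistinct p ⌊Real.exp ((k : ℝ) ^ ξ + a) / c⌋₊ - k) /
      (1 / ξ * (k : ℝ) ^ (1 - ξ))) atTop (𝓝 (Real.eulerMascheroniConstant + a)) := by
  have hden : Tendsto (fun k : ℕ => 1 / ξ * (k : ℝ) ^ (1 - ξ)) atTop atTop :=
    (tendsto_natCast_rpow_atTop (by linarith)).const_mul_atTop (by positivity)
  refine tendsto_order.2 ⟨fun u hu => ?_, fun u hu => ?_⟩
  · obtain ⟨δ, hδ, hδu⟩ : ∃ δ > 0, u < Real.eulerMascheroniConstant + (a - δ) :=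
      ⟨(Real.eulerMascheroniConstant + a - u) / 2, by linarith, by linarith⟩
    obtain ⟨K, hK⟩ := eventually_meanDistinct_bounds h0 h1 hsum hc hξ hξ1 hp a hδ
    have hlim := (tendsto_poissonMean_natCast_rpow hξ hξ1 (a - δ)).sub (hden.const_div_atTop K)
    rw [sub_zero] at hlim
    filter_upwards [hK, hlim.eventually (lt_mem_nhds hδu), hden.eventually_gt_atTop 0]
      with k hk hk2 hk3
    refine hk2.trans_le ?_
    rw [← sub_div]
    exact div_le_div_of_nonneg_right (by linarith) hk3.le
  · obtain ⟨δ, hδ, hδu⟩ : ∃ δ > 0, Real.eulerMascheroniConstant + (a + δ) < u :=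
      ⟨(u - (Real.eulerMascheroniConstant + a)) / 2, by linarith, by linarith⟩
    obtain ⟨K, hK⟩ := eventually_meanDistinct_bounds h0 h1 hsum hc hξ hξ1 hp a hδ
    have hlim := (tendsto_poissonMean_natCast_rpow hξ hξ1 (a + δ)).add (hden.const_div_atTop K)
    rw [add_zero] at hlim
    filter_upwards [hK, hlim.eventually (gt_mem_nhds hδu), hden.eventually_gt_atTop 0]
      with k hk hk2 hk3
    refine lt_of_le_of_lt ?_ hk2
    rw [← add_div]
    exact div_le_div_of_nonneg_right (by linarith) hk3.le

/-! ### The fault probability -/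

/-- The decreasing `q` at `N a k` is squeezed between slopes of the mean over neighbouring windows
`N b k`. In these slopes $\gamma$ cancels, leaving $(b-a)/(e^b-e^a)$ times the tail, and $b\to a$
gives $e^{-a}$. -/
lemma tendsto_fault_div_tail {Ω : Type*} [MeasurableSpace Ω] {μ : Measure Ω}
    [IsProbabilityMeasure μ] {R : ℤ → Ω → ℕ+} {p : ℕ+ → ℝ} (hR : IsRequestFlow μ R p)
    {c ξ : ℝ} (hc : 0 < c) (hξ : 0 < ξ) (hξ1 : ξ < 1)
    (hp : p ~[atTop] fun i : ℕ+ => c * Real.exp (-((i : ℝ) ^ ξ)))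
    {F : ℕ → ℝ} (hF : F ~[atTop] fun k : ℕ => c * stretchedTail ξ k) (a : ℝ) :
    Tendsto (fun k : ℕ =>
      (∑' i, p i * (1 - p i) ^ ⌊Real.exp ((k : ℝ) ^ ξ + a) / c⌋₊) / F k)
      atTop (𝓝 (Real.exp (-a))) := by
  set N : ℝ → ℕ → ℕ := fun a k => ⌊Real.exp ((k : ℝ) ^ ξ + a) / c⌋₊ with hN
  have hM := tendsto_meanDistinct hR.nonneg hR.le_one hR.hasSum.summable hc hξ hξ1 hp
  have hNlim := tendsto_floor_exp_div hc hξ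
  have hmono {a b : ℝ} (hab : a ≤ b) (k : ℕ) : N a k ≤ N b k :=
    Nat.floor_mono (by gcongr)
  have hg0 : ∀ᶠ k : ℕ in atTop, 0 < c * stretchedTail ξ k := by
    filter_upwards [eventually_gt_atTop 0] with k hk
    have : (0 : ℝ) < k := by exact_mod_cast hk
    rw [stretchedTail]
    positivity
  have hF0 := hF.eventually_pos hg0
  have hgF : Tendsto (fun k : ℕ => c * stretchedTail ξ k / F k) atTop (𝓝 1) :=
    (isEquivalent_iff_tendsto_one (hF0.mono fun k hk => hk.ne')).1 hF.symm
  have hquot {a b : ℝ} (hab : a < b) : Tendsto (fun k : ℕ =>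
      (meanDistinct p (N b k) - meanDistinct p (N a k)) / ((N b k : ℝ) - N a k) / F k) atTop
      (𝓝 ((b - a) / (Real.exp b - Real.exp a))) := by
    have hne : Real.exp b - Real.exp a ≠ 0 := (sub_pos.2 (Real.exp_lt_exp.2 hab)).ne'
    have h := (((hM b).sub (hM a)).div ((hNlim b).sub (hNlim a)) hne).mul hgF
    rw [mul_one, add_sub_add_left_eq_sub] at h
    refine h.congr' ?_
    filter_upwards [hF0, eventually_gt_atTop 0] with k hFk hk
    have hk0 : (0 : ℝ) < k := by exact_mod_cast hk
    have he := Real.exp_pos (-(k : ℝ) ^ ξ)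
    have hh : 0 < 1 / ξ * (k : ℝ) ^ (1 - ξ) := by positivity
    simp only [stretchedTail]
    change ((meanDistinct p (N b k) - k) / (1 / ξ * (k : ℝ) ^ (1 - ξ)) -
        (meanDistinct p (N a k) - k) / (1 / ξ * (k : ℝ) ^ (1 - ξ))) /
        ((N b k : ℝ) * (c * Real.exp (-((k : ℝ) ^ ξ))) -
          (N a k : ℝ) * (c * Real.exp (-((k : ℝ) ^ ξ)))) *
        (c * (1 / ξ * (k : ℝ) ^ (1 - ξ) * Real.exp (-(k : ℝ) ^ ξ)) / F k) = _
    rw [← sub_div, sub_sub_sub_cancel_right, ← sub_mul]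
    generalize 1 / ξ * (k : ℝ) ^ (1 - ξ) = H at hh
    generalize Real.exp (-(k : ℝ) ^ ξ) = e at he
    generalize meanDistinct p (N b k) - meanDistinct p (N a k) = X
    have e1 : X / H * (c * (H * e)) = X * (c * e) := by field_simp
    rw [div_mul_div_comm, e1, mul_right_comm _ (c * e), mul_div_mul_right _ _ (by positivity),
      div_div]
  have hNlt {a b : ℝ} (hab : a < b) : ∀ᶠ k : ℕ in atTop, (0 : ℝ) < (N b k : ℝ) - N a k := by
    filter_upwards [((hNlim b).sub (hNlim a)).eventually
      (lt_mem_nhds (sub_pos.2 (Real.exp_lt_exp.2 hab)))] with k hk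
    rw [← sub_mul] at hk
    exact pos_of_mul_pos_left hk (by positivity)
  refine tendsto_order.2 ⟨fun u hu => ?_, fun u hu => ?_⟩
  · obtain ⟨δ, hδ, hδu⟩ : ∃ δ > 0, u < Real.exp (-a - δ) := by
      have hcont : Tendsto (fun δ : ℝ => Real.exp (-a - δ)) (𝓝[>] 0) (𝓝 (Real.exp (-a))) := by
        have : Continuous fun δ : ℝ => Real.exp (-a - δ) := by fun_prop
        simpa using (this.tendsto 0).mono_left nhdsWithin_le_nhds
      obtain ⟨δ, h1, h2⟩ := ((hcont.eventually (lt_mem_nhds hu)).and self_mem_nhdsWithin).exists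
      exact ⟨δ, h2, h1⟩
    have hab : a < a + δ := by linarith
    have hle : Real.exp (-a - δ) ≤ (a + δ - a) / (Real.exp (a + δ) - Real.exp a) := by
      rw [le_div_iff₀ (sub_pos.2 (Real.exp_lt_exp.2 hab)), mul_sub, ← Real.exp_add, ← Real.exp_add]
      have e1 : -a - δ + (a + δ) = 0 := by ring
      have e2 : -a - δ + a = -δ := by ring
      rw [e1, e2, Real.exp_zero]
      linarith [Real.add_one_le_exp (-δ)]
    filter_upwards [hF0, hNlt hab, (hquot hab).eventually (lt_mem_nhds (hδu.trans_le hle))]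
      with k hFk hNk hk
    refine hk.trans_le (div_le_div_of_nonneg_right ?_ hFk.le)
    rw [div_le_iff₀ hNk, mul_comm]
    exact hR.meanDistinct_sub_le (hmono hab.le k)
  · obtain ⟨δ, hδ, hδu⟩ : ∃ δ > 0, Real.exp (-a + δ) < u := by
      have hcont : Tendsto (fun δ : ℝ => Real.exp (-a + δ)) (𝓝[>] 0) (𝓝 (Real.exp (-a))) := by
        have : Continuous fun δ : ℝ => Real.exp (-a + δ) := by fun_prop
        simpa using (this.tendsto 0).mono_left nhdsWithin_le_nhds
      obtain ⟨δ, h1, h2⟩ := ((hcont.eventually (gt_mem_nhds hu)).and self_mem_nhdsWithin).exists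
      exact ⟨δ, h2, h1⟩
    have hab : a - δ < a := by linarith
    have hle : (a - (a - δ)) / (Real.exp a - Real.exp (a - δ)) ≤ Real.exp (-a + δ) := by
      rw [div_le_iff₀ (sub_pos.2 (Real.exp_lt_exp.2 hab)), mul_sub, ← Real.exp_add, ← Real.exp_add]
      have e1 : -a + δ + a = δ := by ring
      have e2 : -a + δ + (a - δ) = 0 := by ring
      rw [e1, e2, Real.exp_zero]
      linarith [Real.add_one_le_exp δ]
    filter_upwards [hF0, hNlt hab, (hquot hab).eventually (gt_mem_nhds (hle.trans_lt hδu))]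
      with k hFk hNk hk
    refine lt_of_le_of_lt (div_le_div_of_nonneg_right ?_ hFk.le) hk
    rw [le_div_iff₀ hNk, mul_comm]
    exact hR.le_meanDistinct_sub (hmono hab.le k)

/-- Deviations of the order of the fluctuation scale are negligible against the tail. -/
lemma tendsto_exp_neg_sq_div_tail {c ξ : ℝ} (hc : 0 < c) (hξ : 0 < ξ) (hξ1 : ξ < 1 / 3)
    {F : ℕ → ℝ} (hF : F ~[atTop] fun k : ℕ => c * stretchedTail ξ k) {M : ℕ → ℝ} {d : ℝ}
    (hd : d ≠ 0)
    (hM : Tendsto (fun k : ℕ => (M k - k) / (1 / ξ * (k : ℝ) ^ (1 - ξ))) atTop (𝓝 d)) :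
    Tendsto (fun k : ℕ => Real.exp (-((k - M k) ^ 2 / (8 * k))) / F k) atTop (𝓝 0) := by
  have hg0 : ∀ᶠ k : ℕ in atTop, 0 < c * stretchedTail ξ k := by
    filter_upwards [eventually_gt_atTop 0] with k hk
    have : (0 : ℝ) < k := by exact_mod_cast hk
    rw [stretchedTail]
    positivity
  have hF0 := hF.eventually_pos hg0
  have hgF : Tendsto (fun k : ℕ => c * stretchedTail ξ k / F k) atTop (𝓝 1) :=
    (isEquivalent_iff_tendsto_one (hF0.mono fun k hk => hk.ne')).1 hF.symm
  -- The Chernoff exponent is $k^\xi$ times the first term, which diverges because $1-3\xi>0$; the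
  -- `- 1` absorbs the factor $e^{-k^\xi}$ of the tail.
  have h1 : Tendsto (fun k : ℕ => ((M k - k) / (1 / ξ * (k : ℝ) ^ (1 - ξ))) ^ 2 *
      ((k : ℝ) ^ (1 - 3 * ξ) / (8 * ξ ^ 2)) - 1) atTop atTop := by
    refine tendsto_atTop_add_const_right _ (-1) ?_
    exact Tendsto.pos_mul_atTop (by positivity : 0 < d ^ 2) (hM.pow 2)
      ((tendsto_natCast_rpow_atTop (by linarith)).atTop_div_const (by positivity))
  have h2 : Tendsto (fun k : ℕ => Real.exp (-((k : ℝ) ^ ξ *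
      (((M k - k) / (1 / ξ * (k : ℝ) ^ (1 - ξ))) ^ 2 *
      ((k : ℝ) ^ (1 - 3 * ξ) / (8 * ξ ^ 2)) - 1)))) atTop (𝓝 0) :=
    Real.tendsto_exp_neg_atTop_nhds_zero.comp ((tendsto_natCast_rpow_atTop hξ).atTop_mul_atTop₀ h1)
  have h3 : Tendsto (fun k : ℕ => (c * (1 / ξ * (k : ℝ) ^ (1 - ξ)))⁻¹) atTop (𝓝 0) :=
    tendsto_inv_atTop_zero.comp (((tendsto_natCast_rpow_atTop (by linarith)).const_mul_atTop
      (by positivity)).const_mul_atTop hc)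
  have h4 := (h2.mul h3).mul hgF
  rw [mul_zero, zero_mul] at h4
  refine h4.congr' ?_
  filter_upwards [hF0, eventually_gt_atTop 0] with k hFk hk
  have hk0 : (0 : ℝ) < k := by exact_mod_cast hk
  have hE : (k - M k) ^ 2 / (8 * k) = (k : ℝ) ^ ξ *
      (((M k - k) / (1 / ξ * (k : ℝ) ^ (1 - ξ))) ^ 2 *
      ((k : ℝ) ^ (1 - 3 * ξ) / (8 * ξ ^ 2)) - 1) + (k : ℝ) ^ ξ := by
    have e1 : (k : ℝ) ^ ξ * (k : ℝ) ^ (1 - 3 * ξ) * k = ((k : ℝ) ^ (1 - ξ)) ^ 2 := by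
      rw [← Real.rpow_add hk0, ← Real.rpow_add_one hk0.ne', ← Real.rpow_natCast,
        ← Real.rpow_mul hk0.le]
      congr 1
      push_cast
      ring
    have e2 : (k : ℝ) ^ (1 - ξ) ≠ 0 := by positivity
    have e3 : (k - M k) ^ 2 / (8 * k) = (M k - k) ^ 2 *
        ((k : ℝ) ^ ξ * (k : ℝ) ^ (1 - 3 * ξ) * k) / (8 * k * ((k : ℝ) ^ (1 - ξ)) ^ 2) := by
      rw [e1]
      field_simp
      ring
    rw [e3]
    field_simp
    ring
  rw [hE, neg_add, Real.exp_add, stretchedTail]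
  have hh : 0 < c * (1 / ξ * (k : ℝ) ^ (1 - ξ)) := by positivity
  field_simp

/-! ### The limit -/

theorem corollary2 {Ω : Type*} [MeasurableSpace Ω] (μ : Measure Ω) [IsProbabilityMeasure μ]
    (R : ℤ → Ω → ℕ+) (p : ℕ+ → ℝ) (hR : IsRequestFlow μ R p)
    (c ξ : ℝ) (hc : 0 < c) (hξ₀ : 0 < ξ) (hξ₁ : ξ < 1 / 3)
    (hp : p ~[atTop] fun i : ℕ+ => c * Real.exp (-((i : ℝ) ^ ξ)))
    (s : ℕ+ → ℝ≥0) (hs : ∀ i, s i = 1) :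
    -- `C_0` is the total size in front of the requested item
    Tendsto
      (fun x : ℝ =>
        μ.real {ω | ENNReal.ofReal x < mtfCost s (fun n => R n ω) 0} / μ.real {ω | x < (R 0 ω : ℝ)})
      atTop (𝓝 (Real.exp Real.eulerMascheroniConstant)) ∧
    -- the same with the position of the requested item (the items in front of it, and itself)
    Tendsto
      (fun x : ℝ =>
        μ.real {ω | ENNReal.ofReal x < mtfCost s (fun n => R n ω) 0 + 1} /
          μ.real {ω | x < (R 0 ω : ℝ)})
      atTop (𝓝 (Real.exp Real.eulerMascheroniConstant)) := by
  have hξ1 : ξ < 1 := by linarith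
  set F : ℕ → ℝ := fun k => ∑' j : ℕ, p (k + j).succPNat with hFdef
  have hF : F ~[atTop] fun k : ℕ => c * stretchedTail ξ k :=
    isEquivalent_tail hR.hasSum.summable hξ₀ hξ1 hp hc
  have hFx {x : ℝ} (hx : 0 ≤ x) : μ.real {ω | x < (R 0 ω : ℝ)} = F ⌊x⌋₊ := hR.tail_eq_tsum hx
  have hF0 (k : ℕ) : 0 ≤ F k := tsum_nonneg fun j => hR.nonneg _
  set N : ℝ → ℕ → ℕ := fun a k => ⌊Real.exp ((k : ℝ) ^ ξ + a) / c⌋₊ with hN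
  have hM := tendsto_meanDistinct hR.nonneg hR.le_one hR.hasSum.summable hc hξ₀ hξ1 hp
  have hfault := tendsto_fault_div_tail hR hc hξ₀ hξ1 hp hF
  have hfloor := tendsto_nat_floor_atTop (α := ℝ)
  -- Only a lower bound for the cost and an upper bound for the position are needed; this gives the
  -- other two.
  have hle {x : ℝ} : μ.real {ω | ENNReal.ofReal x < mtfCost s (fun n => R n ω) 0} ≤
      μ.real {ω | ENNReal.ofReal x < mtfCost s (fun n => R n ω) 0 + 1} :=
    measureReal_mono fun ω (hω : ENNReal.ofReal x < _) =>
      show ENNReal.ofReal x < _ from hω.trans_le le_self_add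
  have hlower (u : ℝ) (hu : u < Real.exp Real.eulerMascheroniConstant) : ∀ᶠ x : ℝ in atTop,
      u < μ.real {ω | ENNReal.ofReal x < mtfCost s (fun n => R n ω) 0} /
        μ.real {ω | x < (R 0 ω : ℝ)} := by
    -- For `a` above $-\gamma$ the mean exceeds `k`, so at most `k` distinct items is a rare event.
    obtain ⟨a, ha, hau⟩ : ∃ a, -Real.eulerMascheroniConstant < a ∧ u < Real.exp (-a) := by
      have hcont : Tendsto (fun a : ℝ => Real.exp (-a)) (𝓝[>] (-Real.eulerMascheroniConstant))
          (𝓝 (Real.exp Real.eulerMascheroniConstant)) := by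
        have : Continuous fun a : ℝ => Real.exp (-a) := by fun_prop
        simpa using (this.tendsto (-Real.eulerMascheroniConstant)).mono_left nhdsWithin_le_nhds
      obtain ⟨a, h1, h2⟩ := ((hcont.eventually (lt_mem_nhds hu)).and self_mem_nhdsWithin).exists
      exact ⟨a, h2, h1⟩
    have hd : 0 < Real.eulerMascheroniConstant + a := by linarith
    have hdev := tendsto_exp_neg_sq_div_tail hc hξ₀ hξ₁ hF hd.ne' (hM a)
    have hlim := (hfault a).sub hdev
    rw [sub_zero] at hlim
    -- The excess of the mean over `k` is $o(k)$, whence the bound `2 * k` required by the lower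
    -- tail estimate.
    have hratio : Tendsto (fun k : ℕ => (meanDistinct p (N a k) - k) /
        (1 / ξ * (k : ℝ) ^ (1 - ξ)) * (1 / ξ * (k : ℝ) ^ (-ξ))) atTop (𝓝 0) := by
      have := (hM a).mul (((tendsto_rpow_neg_atTop hξ₀).comp
        (tendsto_natCast_atTop_atTop (R := ℝ))).const_mul (1 / ξ))
      simpa using this
    have hk : ∀ᶠ k : ℕ in atTop, ∀ x : ℝ, 0 ≤ x → ⌊x⌋₊ = k →
        u < μ.real {ω | ENNReal.ofReal x < mtfCost s (fun n => R n ω) 0} /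
          μ.real {ω | x < (R 0 ω : ℝ)} := by
      filter_upwards [hlim.eventually (lt_mem_nhds hau), (hM a).eventually (lt_mem_nhds hd),
        hratio.eventually (gt_mem_nhds zero_lt_one), eventually_gt_atTop 0]
        with k hk1 hk2 hk3 hk0 x hx hxk
      have hk0' : (0 : ℝ) < k := by exact_mod_cast hk0
      have hh : 0 < 1 / ξ * (k : ℝ) ^ (1 - ξ) := by positivity
      have hMk : (k : ℝ) ≤ meanDistinct p (N a k) := by
        have := (div_pos_iff_of_pos_right hh).1 hk2
        linarith
      have hMk2 : meanDistinct p (N a k) ≤ 2 * k := by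
        have e : (k : ℝ) ^ (1 - ξ) = k * (k : ℝ) ^ (-ξ) := by
          rw [sub_eq_add_neg, Real.rpow_add hk0', Real.rpow_one]
        have e2 : (k : ℝ) ^ (-ξ) ≠ 0 := by positivity
        have e3 : (meanDistinct p (N a k) - k) / (1 / ξ * (k : ℝ) ^ (1 - ξ)) *
            (1 / ξ * (k : ℝ) ^ (-ξ)) = (meanDistinct p (N a k) - k) / k := by
          rw [e]
          field_simp
        rw [e3, div_lt_one hk0'] at hk3
        linarith
      rw [hFx hx, hxk]
      refine hk1.trans_le ?_
      rw [← sub_div]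
      refine div_le_div_of_nonneg_right ?_ (hF0 k)
      refine le_trans ?_ (hR.le_measureReal_mtfCost hs (N a k) hx)
      rw [hxk]
      exact sub_le_sub_left (hR.measureReal_card_le_le _ k hk0 hMk hMk2) _
    filter_upwards [hfloor.eventually hk, eventually_ge_atTop 0] with x hx hx0
    exact hx x hx0 rfl
  have hupper (u : ℝ) (hu : Real.exp Real.eulerMascheroniConstant < u) : ∀ᶠ x : ℝ in atTop,
      μ.real {ω | ENNReal.ofReal x < mtfCost s (fun n => R n ω) 0 + 1} /
        μ.real {ω | x < (R 0 ω : ℝ)} < u := by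
    -- Now the mean falls short of `k`, and at least `k` distinct items is the rare event.
    obtain ⟨a, ha, hau⟩ : ∃ a, a < -Real.eulerMascheroniConstant ∧ Real.exp (-a) < u := by
      have hcont : Tendsto (fun a : ℝ => Real.exp (-a)) (𝓝[<] (-Real.eulerMascheroniConstant))
          (𝓝 (Real.exp Real.eulerMascheroniConstant)) := by
        have : Continuous fun a : ℝ => Real.exp (-a) := by fun_prop
        simpa using (this.tendsto (-Real.eulerMascheroniConstant)).mono_left nhdsWithin_le_nhds
      obtain ⟨a, h1, h2⟩ := ((hcont.eventually (gt_mem_nhds hu)).and self_mem_nhdsWithin).exists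
      exact ⟨a, h2, h1⟩
    have hd : Real.eulerMascheroniConstant + a < 0 := by linarith
    have hdev := tendsto_exp_neg_sq_div_tail hc hξ₀ hξ₁ hF hd.ne (hM a)
    have hlim := (hfault a).add hdev
    rw [add_zero] at hlim
    have hk : ∀ᶠ k : ℕ in atTop, ∀ x : ℝ, 0 ≤ x → ⌊x⌋₊ = k →
        μ.real {ω | ENNReal.ofReal x < mtfCost s (fun n => R n ω) 0 + 1} /
          μ.real {ω | x < (R 0 ω : ℝ)} < u := by
      filter_upwards [hlim.eventually (gt_mem_nhds hau), (hM a).eventually (gt_mem_nhds hd),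
        eventually_gt_atTop 0] with k hk1 hk2 hk0 x hx hxk
      have hk0' : (0 : ℝ) < k := by exact_mod_cast hk0
      have hh : 0 < 1 / ξ * (k : ℝ) ^ (1 - ξ) := by positivity
      have hMk : meanDistinct p (N a k) ≤ k := by
        rw [div_lt_iff₀ hh, zero_mul] at hk2
        linarith
      rw [hFx hx, hxk]
      refine lt_of_le_of_lt ?_ hk1
      rw [← add_div]
      refine div_le_div_of_nonneg_right ?_ (hF0 k)
      refine (hR.measureReal_mtfCost_le hs (N a k) hx).trans ?_
      rw [hxk]
      refine add_le_add_right ((hR.measureReal_card_ge_le _ k hk0 hMk).trans ?_) _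
      -- The upper tail constant $4$ is weakened to the $8$ shared with the lower tail.
      refine Real.exp_le_exp.2 (neg_le_neg ?_)
      gcongr
      norm_num
    filter_upwards [hfloor.eventually hk, eventually_ge_atTop 0] with x hx hx0
    exact hx x hx0 rfl
  refine ⟨tendsto_order.2 ⟨hlower, fun u hu => ?_⟩, tendsto_order.2 ⟨fun u hu => ?_, hupper⟩⟩
  · filter_upwards [hupper u hu] with x hx
    exact (div_le_div_of_nonneg_right hle measureReal_nonneg).trans_lt hx
  · filter_upwards [hlower u hu] with x hx
    exact hx.trans_le (div_le_div_of_nonneg_right hle measureReal_nonneg)
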